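/- Let $G=(E_G,V_G,\partial)$ be a finite graph (multiple edges and selfloops allowed) with a set of external vertices $V^{ext}_G\subseteq V_G$ carrying momenta $q_v\in\mathbb{C}^D$ and a set of massive edges $E^M_G\subseteq E_G$ carrying masses $m_e\in\mathbb{C}\setminus\{0\}$; put $q_v=0$ for $v\notin V^{ext}_G$ and $m_e=0$ for $e\notin E_G^M$, and assume that the momenta sum to $0$ in each connected component of $G$. For $p\in\mathbb{C}^D$ write $p^2=\sum_i (p^i)^2$. Assume that $G$ has generic euclidean kinematics: for every nonempty proper subset $\emptyset\ne I\subsetneq V^{ext}_G$ and every $e\in E^M_G$, $$\operatorname{Re}\Big(\sum_{v\in I}q_v\Big)^2>0,\qquad \operatorname{Re}\Big(\sum_{v\in I}q_v\Big)^2+\operatorname{Re}(m_e^2)>0 .$$ Assume moreover that the kinematics are non-trivial, i.e. $V^{ext}_G$ and $E^M_G$ are not both empty, and that $|V_G^{ext}|\neq 1$ (a single external vertex carries zero momentum). If $G$ is connected, let $$\psi_G=\sum_T\prod_{e\notin T}\alpha_e,\qquad \varphi_G=\sum_{T_1\cup T_2}q_{T_1}^2\prod_{e\notin T_1\cup T_2}\alpha_e,\qquad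 \Phi_G=\varphi_G+\Big(\sum_{e}m_e^2\alpha_e\Big)\psi_G,$$ where $T$ runs over the spanning trees and $T_1\cup T_2$ over the spanning 2-trees of $G$ (spanning forests with exactly two components, isolated vertices allowed), and $q_{T_1}=\sum_{v\in V(T_1)}q_v$. If $G$ has connected components $G_1,\dots,G_k$, let $\psi_G=\prod_i\psi_{G_i}$ and $\Phi_G=\sum_i\Phi_{G_i}\prod_{j\ne i}\psi_{G_j}$. Let $P_G\subset\mathbb{R}^{E_G}$ be the Newton polytope of $\psi_G\Phi_G$. For $\gamma\subseteq E_G$, viewed as the subgraph consisting of the edges in $\gamma$ and their endpoints, let $h^1(\gamma)$ be its first Betti number, and let $\delta^{mm}_\gamma=1$ if $\gamma$ contains all massive edges and contains all external vertices in a single connected component, and $\delta^{mm}_\gamma=0$ otherwise. Let $s_G(\gamma)=2h^1(\gamma)+\delta^{mm}_\gamma$. Then: 1. $P_G$ equals the base polyhedron $$P(s_G)=\Big\{m\in\mathbb{R}^{E_G}\ \Big|\ \sum_{e\in E_G}m_e=s_G(E_G),\ \sum_{e\in\gamma}m_e\ge s_G(\gamma)\text{ for all }\gamma\subsetneq E_G\Big\}.$$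 2. $P_G$ is a generalized permutahedron, i.e. a lattice polytope lying in a hyperplane $\sum_e m_e=d$ whose normal fan is a coarsening of the normal fan of the regular permutahedron of $E_G$ (the convex hull of all vectors whose coordinates are $1,\dots,|E_G|$ in some order). 3. $s_G(\emptyset)=0$ and $s_G$ is supermodular: $s_G(I)+s_G(J)\le s_G(I\cap J)+s_G(I\cup J)$ for all $I,J\subseteq E_G$. -/

import Mathlib

noncomputable section

open scoped Classical

/-! ### Polytopes and generalized permutahedra in `ℝ^E` -/

section Polyhedra

variable {E : Type*} [Fintype E]

/-- A lattice polytope: the convex hull of a nonempty finite set of integer points. -/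
def IsLatticePolytope (P : Set (E → ℝ)) : Prop :=
  ∃ A : Finset (E → ℤ), A.Nonempty ∧
    P = convexHull ℝ ((fun (a : E → ℤ) (e : E) => (a e : ℝ)) '' (A : Set (E → ℤ)))

/-- The face `F_u P` of `P` on which the linear form `⟨·, u⟩` is minimal. -/
def polyFace (P : Set (E → ℝ)) (u : E → ℝ) : Set (E → ℝ) :=
  {m ∈ P | ∀ m' ∈ P, ∑ e, m e * u e ≤ ∑ e, m' e * u e}

/-- The inner normal cone `σ_Q` of a face `Q` of `P`: all `w` whose form is minimal along `Q`. -/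
def normalCone (P Q : Set (E → ℝ)) : Set (E → ℝ) :=
  {w | Q ⊆ polyFace P w}

/-- The (possibly degenerate) normal fan of `P`: the cones `σ_Q` of all nonempty faces `Q`. -/
def normalFan (P : Set (E → ℝ)) : Set (Set (E → ℝ)) :=
  {σ | ∃ u, (polyFace P u).Nonempty ∧ σ = normalCone P (polyFace P u)}

/-- `S₁` is a refinement of `S₂` (equivalently `S₂` is a coarsening of `S₁`): the supports agree
and every cone of `S₁` is contained in some cone of `S₂`. -/
def FanRefines (S₁ S₂ : Set (Set (E → ℝ))) : Prop :=
  ⋃₀ S₁ = ⋃₀ S₂ ∧ ∀ σ₁ ∈ S₁, ∃ σ₂ ∈ S₂, σ₁ ⊆ σ₂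

variable (E) in
/-- The regular permutahedron of `E`: the convex hull of the points whose coordinates are
`1, …, |E|` in some order. -/
def permutahedron : Set (E → ℝ) :=
  convexHull ℝ (Set.range fun (σ : E ≃ Fin (Fintype.card E)) (e : E) => ((σ e : ℕ) : ℝ) + 1)

/-- A generalized permutahedron: a lattice polytope contained in a hyperplane `∑ m_e = d` whose
normal fan is a coarsening of the normal fan of the permutahedron. -/
def IsGeneralizedPermutahedron (P : Set (E → ℝ)) : Prop :=
  IsLatticePolytope P ∧ (∃ d : ℝ, P ⊆ {m | ∑ e, m e = d}) ∧
    FanRefines (normalFan (permutahedron E)) (normalFan P)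

/-- The base polyhedron `P(z)` of a set function `z`. -/
def basePolyhedron (z : Finset E → ℤ) : Set (E → ℝ) :=
  {m | ∑ e, m e = z Finset.univ ∧ ∀ I : Finset E, I ≠ Finset.univ → (z I : ℝ) ≤ ∑ e ∈ I, m e}

/-- Supermodularity of a set function. -/
def IsSupermodular (z : Finset E → ℤ) : Prop :=
  ∀ I J : Finset E, z I + z J ≤ z (I ∩ J) + z (I ∪ J)

/-- The Newton polytope of a polynomial: the convex hull of the exponents of its monomials. -/
def newtonPolytope (f : MvPolynomial E ℂ) : Set (E → ℝ) :=
  convexHull ℝ ((fun (d : E →₀ ℕ) (e : E) => (d e : ℝ)) '' (f.support : Set (E →₀ ℕ)))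

end Polyhedra

/-! ### Graphs -/

/-- A graph with vertices `V` and edges `E`, possibly with multiple edges and selfloops, given by
the map sending an edge to the unordered pair of its endpoints. -/
structure EdgeGraph (V E : Type*) where
  ends : E → Sym2 V

namespace EdgeGraph

variable {V E : Type*} [Fintype V] [Fintype E] (G : EdgeGraph V E)

/-- The simple graph on `V` recording the adjacencies given by the edges in `I`. It has the same
connected components as the subgraph with vertex set `V` and edge set `I`. -/
def skeleton (I : Finset E) : SimpleGraph V :=
  SimpleGraph.fromEdgeSet (G.ends '' (I : Set E))

/-- The connected components of the graph. -/
abbrev Component : Type _ := (G.skeleton Finset.univ).ConnectedComponent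

/-- The edges of a connected component. -/
def edgesOf (c : G.Component) : Finset E :=
  Finset.univ.filter fun e => ∀ v ∈ G.ends e, v ∈ c.supp

/-- The cellular boundary map `ℚ^E → ℚ^V`, for some choice of orientation of the edges. -/
def boundary : (E → ℚ) →ₗ[ℚ] (V → ℚ) :=
  Fintype.linearCombination ℚ fun e : E =>
    (Pi.single (Quot.out (G.ends e)).2 1 - Pi.single (Quot.out (G.ends e)).1 1 : V → ℚ)

/-- The first homology `H₁(γ, ℚ) ⊆ ℚ^E` of the subgraph with edge set `I`: the cycles supported
on `I`. -/
def cycles (I : Finset E) : Submodule ℚ (E → ℚ) where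
  carrier := {x | (∀ e ∉ I, x e = 0) ∧ G.boundary x = 0}
  add_mem' := by
    rintro x y ⟨hx, hx'⟩ ⟨hy, hy'⟩
    exact ⟨fun e he => by simp [hx e he, hy e he], by simp [hx', hy']⟩
  zero_mem' := ⟨fun _ _ => rfl, map_zero _⟩
  smul_mem' := by
    rintro r x ⟨hx, hx'⟩
    exact ⟨fun e he => by simp [hx e he], by simp [hx']⟩

/-- The loop number (first Betti number) `h¹` of the subgraph with edge set `I`. -/
def h1 (I : Finset E) : ℕ := Module.finrank ℚ (G.cycles I)

/-- The edge sets of the spanning trees of a connected component `c`: no cycles, and all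
vertices of `c` are connected. -/
def spanningTrees (c : G.Component) : Finset (Finset E) :=
  (G.edgesOf c).powerset.filter fun T =>
    G.h1 T = 0 ∧ ∀ v ∈ c.supp, ∀ w ∈ c.supp, (G.skeleton T).Reachable v w

/-- The edge sets of the spanning 2-trees of a connected component `c`: no cycles, and the
vertices of `c` form exactly two connected components (which may be isolated vertices). -/
def spanningTwoTrees (c : G.Component) : Finset (Finset E) :=
  (G.edgesOf c).powerset.filter fun F =>
    G.h1 F = 0 ∧
      Nat.card {d : (G.skeleton F).ConnectedComponent // d.supp ⊆ c.supp} = 2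

end EdgeGraph

/-! ### Feynman graphs -/

/-- The square `p² = ∑ (pⁱ)²` of a complex momentum (bilinear, not hermitian). -/
def momentumSq {D : ℕ} (p : Fin D → ℂ) : ℂ := ∑ i, p i ^ 2

/-- A Feynman graph: a graph with external vertices, massive edges, external momenta in `ℂ^D`
(extended by `0` to all vertices) and masses (extended by `0` to all edges), with momentum
conservation in each connected component. -/
structure FeynmanGraph (V E : Type*) [Fintype V] [Fintype E] (D : ℕ) extends EdgeGraph V E where
  ext : Finset V
  massive : Finset E
  q : V → Fin D → ℂ
  mass : E → ℂ
  q_eq_zero : ∀ v, v ∉ ext → q v = 0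
  mass_ne_zero : ∀ e ∈ massive, mass e ≠ 0
  mass_eq_zero : ∀ e, e ∉ massive → mass e = 0
  conservation : ∀ c : toEdgeGraph.Component, ∑ v ∈ ext.filter (fun v => v ∈ c.supp), q v = 0

namespace FeynmanGraph

variable {V E : Type*} [Fintype V] [Fintype E] {D : ℕ} (G : FeynmanGraph V E D)

/-- Generic euclidean kinematics. -/
def GenericEuclidean : Prop :=
  ∀ I : Finset V, I ⊂ G.ext → I.Nonempty →
    0 < (momentumSq (∑ v ∈ I, G.q v)).re ∧
    ∀ e ∈ G.massive, 0 < (momentumSq (∑ v ∈ I, G.q v)).re + (G.mass e ^ 2).re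

/-- The total momentum flowing into a component `d` of the subgraph with edge set `F`. -/
def momentum (F : Finset E) (d : (G.skeleton F).ConnectedComponent) : Fin D → ℂ :=
  ∑ v ∈ Finset.univ.filter (fun v => v ∈ d.supp), G.q v

/-- The first Symanzik polynomial of a connected component. -/
def psiComp (c : G.Component) : MvPolynomial E ℂ :=
  ∑ T ∈ G.spanningTrees c, ∏ e ∈ G.edgesOf c \ T, MvPolynomial.X e

/-- The tree `T₁` of a 2-tree `F` of `c` containing a base vertex of `c`. -/
def firstTree (c : G.Component) (F : Finset E) : (G.skeleton F).ConnectedComponent :=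
  (G.skeleton F).connectedComponentMk (Quot.out c)

/-- The massless second Symanzik polynomial of a connected component. The choice of `T₁` among
the two trees is irrelevant, see `momentumSq_firstTree`. -/
def phiComp (c : G.Component) : MvPolynomial E ℂ :=
  ∑ F ∈ G.spanningTwoTrees c,
    MvPolynomial.C (momentumSq (G.momentum F (G.firstTree c F))) *
      ∏ e ∈ G.edgesOf c \ F, MvPolynomial.X e

/-- The full second Symanzik polynomial of a connected component. -/
def PhiComp (c : G.Component) : MvPolynomial E ℂ :=
  G.phiComp c +
    (∑ e ∈ G.edgesOf c, MvPolynomial.C (G.mass e ^ 2) * MvPolynomial.X e) * G.psiComp c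

/-- The first Symanzik polynomial: the product over the connected components. -/
def psi : MvPolynomial E ℂ := ∏ c : G.Component, G.psiComp c

/-- The full second Symanzik polynomial `∑ᵢ Φᵢ ∏_{j ≠ i} ψⱼ` over the connected components. -/
def Phi : MvPolynomial E ℂ :=
  ∑ c : G.Component, G.PhiComp c * ∏ c' ∈ Finset.univ.erase c, G.psiComp c'

/-- The Feynman polytope. -/
def feynmanPolytope : Set (E → ℝ) := newtonPolytope (G.psi * G.Phi)

/-- The edge subgraph with edge set `I` (whose vertices are those incident to an edge in `I`)
contains all external vertices in a single connected component. -/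
def IsMomentumSpanning (I : Finset E) : Prop :=
  (∀ v ∈ G.ext, ∃ e ∈ I, v ∈ G.ends e) ∧
    ∀ v ∈ G.ext, ∀ w ∈ G.ext, (G.skeleton I).Reachable v w

/-- Mass-momentum spanning edge subgraphs. -/
def IsMassMomentumSpanning (I : Finset E) : Prop :=
  G.IsMomentumSpanning I ∧ G.massive ⊆ I

/-- The set function `s_G(γ) = 2 h¹(γ) + δ^{mm}_γ`. -/
def sFun (I : Finset E) : ℤ :=
  2 * (G.h1 I : ℤ) + if G.IsMassMomentumSpanning I then 1 else 0

/-- Both trees of a spanning 2-tree give the same squared momentum, by momentum conservation. -/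
theorem momentumSq_firstTree (c : G.Component) (F : Finset E) (hF : F ∈ G.spanningTwoTrees c)
    (d : (G.skeleton F).ConnectedComponent) (hd : d.supp ⊆ c.supp) :
    momentumSq (G.momentum F d) = momentumSq (G.momentum F (G.firstTree c F)) := by
  have hle : G.skeleton F ≤ G.skeleton Finset.univ := by
    unfold EdgeGraph.skeleton
    exact SimpleGraph.fromEdgeSet_mono (Set.image_mono (by simp))
  have hsub : ∀ v ∈ c.supp, ((G.skeleton F).connectedComponentMk v).supp ⊆ c.supp := by
    intro v hv w hw
    rw [SimpleGraph.ConnectedComponent.mem_supp_iff] at hv hw ⊢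
    rw [← hv]
    exact SimpleGraph.ConnectedComponent.sound
      ((SimpleGraph.ConnectedComponent.exact hw).mono hle)
  have hout : (Quot.out c : V) ∈ c.supp := by
    rw [SimpleGraph.ConnectedComponent.mem_supp_iff]
    exact Quot.out_eq c
  set d₀ := G.firstTree c F with hd₀
  have hd₀s : d₀.supp ⊆ c.supp := hsub _ hout
  by_cases hdd : d = d₀
  · rw [hdd]
  have hcard := (Finset.mem_filter.1 hF).2.2
  have hex : ∀ x : (G.skeleton F).ConnectedComponent, x.supp ⊆ c.supp → x = d ∨ x = d₀ := by
    intro x hx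
    obtain ⟨a, b, -, hab⟩ := Nat.card_eq_two_iff.1 hcard
    have h (y : {d : (G.skeleton F).ConnectedComponent // d.supp ⊆ c.supp}) : y = a ∨ y = b := by
      have : y ∈ ({a, b} : Set _) := hab ▸ Set.mem_univ y
      simpa using this
    have h1 := h ⟨x, hx⟩
    have h2 := h ⟨d, hd⟩
    have h3 := h ⟨d₀, hd₀s⟩
    have hne : (⟨d, hd⟩ : {d : (G.skeleton F).ConnectedComponent // d.supp ⊆ c.supp})
      ≠ ⟨d₀, hd₀s⟩ := fun h => hdd (congrArg Subtype.val h)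
    have : (⟨x, hx⟩ : {d : (G.skeleton F).ConnectedComponent // d.supp ⊆ c.supp}) = ⟨d, hd⟩ ∨
      (⟨x, hx⟩ : {d : (G.skeleton F).ConnectedComponent // d.supp ⊆ c.supp}) = ⟨d₀, hd₀s⟩ := by
      grind
    exact this.imp (congrArg Subtype.val) (congrArg Subtype.val)
  have hsum : G.momentum F d + G.momentum F d₀ = 0 := by
    rw [← G.conservation c]
    unfold momentum
    rw [← Finset.sum_union]
    · symm
      apply Finset.sum_subset_zero_on_sdiff
      · intro v hv
        have hv := (Finset.mem_filter.1 hv).2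
        have := hex _ (hsub v hv)
        simp only [Finset.mem_union, Finset.mem_filter, Finset.mem_univ, true_and,
          SimpleGraph.ConnectedComponent.mem_supp_iff]
        exact this
      · intro v hv
        rw [Finset.mem_sdiff] at hv
        apply G.q_eq_zero
        intro hve
        refine hv.2 (Finset.mem_filter.2 ⟨hve, ?_⟩)
        rcases Finset.mem_union.1 hv.1 with h | h
        · exact hd (Finset.mem_filter.1 h).2
        · exact hd₀s (Finset.mem_filter.1 h).2
      · intro v _
        rfl
    · rw [Finset.disjoint_left]
      intro v h1 h2
      have h1 := (Finset.mem_filter.1 h1).2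
      have h2 := (Finset.mem_filter.1 h2).2
      rw [SimpleGraph.ConnectedComponent.mem_supp_iff] at h1 h2
      exact hdd (h1.symm.trans h2)
  have : G.momentum F d = -G.momentum F d₀ := eq_neg_of_add_eq_zero_left hsum
  simp [this, momentumSq]

end FeynmanGraph

end

/-!
The argument rests on a criterion for a polynomial `p` and a set function `z`, called
`Realizes p z`: all exponents of `p` lie in the base polyhedron of `z`, and for every linear order
on `E` the greedy point of `z`, at which the inequalities of all initial segments are equalities, is
an exponent of `p`. By Abel summation the greedy point of an order minimizes every linear form that
decreases along the order, so separating a point from the Newton polytope shows that the latter is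
all of the base polyhedron (`Realizes.newtonPolytope_eq`). The same fact gives that the normal fan
is coarser than that of the permutahedron (`Realizes.isGeneralizedPermutahedron`), and comparing
`z J` with the greedy point for an order with initial segments `I ∩ J`, `I`, `I ∪ J` gives
supermodularity (`Realizes.isSupermodular`). The criterion is multiplicative (`Realizes.mul`):
equality on all initial segments forces the decomposition of a greedy exponent to be unique, so its
coefficient in a product is a product of two coefficients and cannot cancel.

It remains to show that `ψ` realizes `h¹` and that `Φ` realizes `h¹ + δ`. Graph theory enters
through the span `bspan I` of the boundaries of the edges in `I`: its dimension is `|I| - h¹(I)`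
(`h1_add_finrank`), and it decides which vertices are connected by `I` (`reachable_iff`). Spanning
2-trees are the spanning trees with an edge removed, so `ψ` and `Φ` expand over the spanning forests
of the whole graph (`psi_eq`, `Phi_eq`).

For `ψ` the greedy exponent is the complement of the greedy spanning forest `T`. For `Φ` it is this
exponent with the exponent of `f` raised by one, where `f` is the edge at which the initial segments
become mass-momentum spanning. Any other massive edge outside `T` comes before `f`, so it closes a
cycle with `T \ f` and its mass does not enter the coefficient. If `f ∉ T`, then `f` is massive and
the coefficient is `m_f²`. If `f ∈ T`, the coefficient is `q² + m_f²` with `q` the momentum flowing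
through `f` in `T`. Either `T \ f` separates external vertices and genericity applies, or `q = 0`
and `f` is massive (`coeff_Phi_greedy_ne_zero`).
-/

noncomputable section

open scoped Classical

/-! ### Polynomials whose Newton polytope is a base polyhedron -/

section Polyhedra

variable {E : Type*} [Fintype E]

/-- The initial segment of length `k` of the linear order on `E` given by the numbering `σ`. -/
def initSeg (σ : E ≃ Fin (Fintype.card E)) (k : ℕ) : Finset E :=
  Finset.univ.filter fun e => (σ e : ℕ) < k

theorem mem_initSeg {σ : E ≃ Fin (Fintype.card E)} {k : ℕ} {e : E} :
    e ∈ initSeg σ k ↔ (σ e : ℕ) < k := by simp [initSeg]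

theorem initSeg_zero (σ : E ≃ Fin (Fintype.card E)) : initSeg σ 0 = ∅ := by
  ext e; simp [mem_initSeg]

theorem initSeg_card (σ : E ≃ Fin (Fintype.card E)) :
    initSeg σ (Fintype.card E) = Finset.univ := by
  ext e; simp [mem_initSeg]

theorem initSeg_mono (σ : E ≃ Fin (Fintype.card E)) : Monotone (initSeg σ) := by
  intro k l h e he
  rw [mem_initSeg] at *
  omega

theorem initSeg_succ (σ : E ≃ Fin (Fintype.card E)) {k : ℕ} (hk : k < Fintype.card E) :
    initSeg σ (k + 1) = insert (σ.symm ⟨k, hk⟩) (initSeg σ k) := by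
  ext e
  rw [Finset.mem_insert, mem_initSeg, mem_initSeg, Equiv.eq_symm_apply, Fin.ext_iff]
  simp only
  omega

theorem initSeg_succ' (σ : E ≃ Fin (Fintype.card E)) (e : E) :
    initSeg σ ((σ e : ℕ) + 1) = insert e (initSeg σ (σ e)) := by
  rw [initSeg_succ σ (σ e).2]
  simp

theorem initSeg_symm_notMem (σ : E ≃ Fin (Fintype.card E)) (e : E) :
    e ∉ initSeg σ (σ e) := by
  simp [mem_initSeg]

/-- Sums over the initial segments determine a function. -/
theorem eq_of_sum_initSeg_eq {x y : E → ℤ} (σ : E ≃ Fin (Fintype.card E))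
    (h : ∀ k, ∑ e ∈ initSeg σ k, x e = ∑ e ∈ initSeg σ k, y e) : x = y := by
  funext e
  have h1 := h ((σ e : ℕ) + 1)
  rw [initSeg_succ', Finset.sum_insert (initSeg_symm_notMem σ e),
    Finset.sum_insert (initSeg_symm_notMem σ e), h] at h1
  linarith

theorem exists_equiv_antitone (w : E → ℝ) :
    ∃ σ : E ≃ Fin (Fintype.card E), ∀ e f, σ e ≤ σ f → w f ≤ w e := by
  let ε := Fintype.equivFin E
  let g : Fin (Fintype.card E) → ℝ := fun i => -w (ε.symm i)
  refine ⟨ε.trans (Tuple.sort g).symm, fun e f h => ?_⟩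
  have := Tuple.monotone_sort g h
  simpa [g] using this

/-- Abel summation: a form that decreases along `σ` is nonnegative on vectors with nonnegative
sums over the initial segments of `σ` and total sum zero. -/
theorem sum_mul_nonneg_of_antitone {d w : E → ℝ} (σ : E ≃ Fin (Fintype.card E))
    (hw : ∀ e f, σ e ≤ σ f → w f ≤ w e) (hd : ∀ k, 0 ≤ ∑ e ∈ initSeg σ k, d e)
    (h0 : ∑ e, d e = 0) : 0 ≤ ∑ e, d e * w e := by
  have key : ∀ k, k ≤ Fintype.card E → ∀ c, (∀ e ∈ initSeg σ k, c ≤ w e) →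
      c * ∑ e ∈ initSeg σ k, d e ≤ ∑ e ∈ initSeg σ k, d e * w e := by
    intro k
    induction k with
    | zero => simp [initSeg_zero]
    | succ k ih =>
      intro hk c hc
      have hk' : k < Fintype.card E := hk
      have hsum := hd (k + 1)
      rw [initSeg_succ σ hk'] at hc hsum ⊢
      set f := σ.symm ⟨k, hk'⟩ with hf
      have hfn : f ∉ initSeg σ k := by simp [hf, mem_initSeg]
      rw [Finset.sum_insert hfn] at hsum
      rw [Finset.sum_insert hfn, Finset.sum_insert hfn]
      have h1 := ih hk'.le (w f) (fun e he => hw e f (by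
        rw [mem_initSeg] at he
        rw [Fin.le_def, hf, Equiv.apply_symm_apply]
        exact he.le))
      have h2 := mul_le_mul_of_nonneg_right (hc f (Finset.mem_insert_self _ _)) hsum
      linarith
  obtain ⟨c, hc⟩ := (Set.finite_range w).bddBelow
  have := key _ le_rfl c (fun e _ => hc ⟨e, rfl⟩)
  rwa [initSeg_card, h0, mul_zero] at this

/-- `p` realizes the set function `z`: every exponent `d` of `p` lies in the base polyhedron of
`z`, and for each linear order on `E` some exponent of `p` is the greedy point of `z`, at which all
inequalities belonging to initial segments are equalities. -/
structure Realizes (p : MvPolynomial E ℂ) (z : Finset E → ℤ) : Prop where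
  le : ∀ d ∈ p.support, ∀ I : Finset E, z I ≤ ∑ e ∈ I, (d e : ℤ)
  total : ∀ d ∈ p.support, ∑ e, (d e : ℤ) = z Finset.univ
  greedy : ∀ σ : E ≃ Fin (Fintype.card E), ∃ d ∈ p.support, ∀ k,
    ∑ e ∈ initSeg σ k, (d e : ℤ) = z (initSeg σ k)

namespace Realizes

variable {p q : MvPolynomial E ℂ} {z z' : Finset E → ℤ}

theorem map_empty (h : Realizes p z) : z ∅ = 0 := by
  obtain ⟨d, -, hd⟩ := h.greedy (Fintype.equivFin E)
  simpa [initSeg_zero] using (hd 0).symm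

/-- The greedy exponents of `p` and `q` for the same order add up to an exponent of `p * q`: no
other pair of exponents has the same sum, so nothing cancels. -/
theorem mul (h : Realizes p z) (h' : Realizes q z') :
    Realizes (p * q) (fun I => z I + z' I) := by
  have hsupp : ∀ d ∈ (p * q).support, ∃ a ∈ p.support, ∃ b ∈ q.support, a + b = d := by
    intro d hd
    exact Finset.mem_add.1 (MvPolynomial.support_mul p q hd)
  refine ⟨?_, ?_, ?_⟩
  · intro d hd I
    obtain ⟨a, ha, b, hb, rfl⟩ := hsupp d hd
    simp only [Finsupp.add_apply, Nat.cast_add, Finset.sum_add_distrib]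
    exact add_le_add (h.le a ha I) (h'.le b hb I)
  · intro d hd
    obtain ⟨a, ha, b, hb, rfl⟩ := hsupp d hd
    simp only [Finsupp.add_apply, Nat.cast_add, Finset.sum_add_distrib]
    rw [h.total a ha, h'.total b hb]
  · intro σ
    obtain ⟨a, ha, ha'⟩ := h.greedy σ
    obtain ⟨b, hb, hb'⟩ := h'.greedy σ
    refine ⟨a + b, ?_, fun k => ?_⟩
    · rw [MvPolynomial.mem_support_iff, MvPolynomial.coeff_mul, Finset.sum_eq_single (a, b)]
      · exact mul_ne_zero (MvPolynomial.mem_support_iff.1 ha) (MvPolynomial.mem_support_iff.1 hb)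
      · rintro ⟨x, y⟩ hxy hne
        replace hxy : x + y = a + b := Finset.HasAntidiagonal.mem_antidiagonal.1 hxy
        by_contra hc
        have hx : x ∈ p.support := MvPolynomial.mem_support_iff.2 (left_ne_zero_of_mul hc)
        have hy : y ∈ q.support := MvPolynomial.mem_support_iff.2 (right_ne_zero_of_mul hc)
        have hxa : x = a := by
          have : (fun e => (x e : ℤ)) = fun e => (a e : ℤ) := by
            refine eq_of_sum_initSeg_eq σ fun k => ?_
            have h1 := h.le x hx (initSeg σ k)
            have h2 := h'.le y hy (initSeg σ k)
            have h3 : ∑ e ∈ initSeg σ k, ((x + y) e : ℤ) = ∑ e ∈ initSeg σ k, ((a + b) e : ℤ) := by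
              rw [hxy]
            simp only [Finsupp.add_apply, Nat.cast_add, Finset.sum_add_distrib] at h3
            have h4 := ha' k
            have h5 := hb' k
            linarith
          ext e
          exact_mod_cast congrFun this e
        subst hxa
        exact hne (by rw [add_left_cancel hxy])
      · intro hn
        refine absurd ?_ hn
        rw [Finset.HasAntidiagonal.mem_antidiagonal]
    · simp only [Finsupp.add_apply, Nat.cast_add, Finset.sum_add_distrib]
      rw [ha' k, hb' k]

theorem mem_basePolyhedron (h : Realizes p z) {d : E →₀ ℕ} (hd : d ∈ p.support) :
    (fun e => (d e : ℝ)) ∈ basePolyhedron z := by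
  have h1 := h.total d hd
  refine ⟨?_, fun I _ => ?_⟩
  · beta_reduce
    exact_mod_cast h1
  · have h2 := h.le d hd I
    beta_reduce
    exact_mod_cast h2

/-- Along an order for which `w` decreases, the greedy exponent minimizes `w` on the base
polyhedron. -/
theorem sum_mul_le (h : Realizes p z) {σ : E ≃ Fin (Fintype.card E)} {w : E → ℝ}
    (hw : ∀ e f, σ e ≤ σ f → w f ≤ w e) {d : E →₀ ℕ} (hdp : d ∈ p.support)
    (hd : ∀ k, ∑ e ∈ initSeg σ k, (d e : ℤ) = z (initSeg σ k)) {m : E → ℝ}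
    (hm : m ∈ basePolyhedron z) : ∑ e, (d e : ℝ) * w e ≤ ∑ e, m e * w e := by
  have hd' : ∀ k, ∑ e ∈ initSeg σ k, (d e : ℝ) = z (initSeg σ k) := fun k => by
    exact_mod_cast hd k
  have htot : ∑ e, (d e : ℝ) = z Finset.univ := by exact_mod_cast h.total d hdp
  have := sum_mul_nonneg_of_antitone (d := fun e => m e - d e) σ hw (fun k => by
    rw [Finset.sum_sub_distrib, hd']
    by_cases hk : initSeg σ k = Finset.univ
    · rw [hk, hm.1, sub_self]
    · linarith [hm.2 _ hk]) (by rw [Finset.sum_sub_distrib, htot, hm.1, sub_self])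
  simp only [sub_mul, Finset.sum_sub_distrib] at this
  linarith

theorem convex_basePolyhedron (z : Finset E → ℤ) : Convex ℝ (basePolyhedron z) := by
  intro x hx y hy a b ha hb hab
  have hs : ∀ I : Finset E, ∑ e ∈ I, (a • x + b • y) e
      = a * ∑ e ∈ I, x e + b * ∑ e ∈ I, y e := by
    intro I
    simp [Finset.sum_add_distrib, Finset.mul_sum]
  refine ⟨?_, fun I hI => ?_⟩
  · rw [hs, hx.1, hy.1, ← add_mul, hab, one_mul]
  · rw [hs]
    calc (z I : ℝ) = a * z I + b * z I := by rw [← add_mul, hab, one_mul]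
      _ ≤ _ := add_le_add (mul_le_mul_of_nonneg_left (hx.2 I hI) ha)
        (mul_le_mul_of_nonneg_left (hy.2 I hI) hb)

theorem newtonPolytope_eq (h : Realizes p z) : newtonPolytope p = basePolyhedron z := by
  apply subset_antisymm
  · refine convexHull_min ?_ (convex_basePolyhedron z)
    rintro _ ⟨d, hd, rfl⟩
    exact h.mem_basePolyhedron hd
  · intro m hm
    by_contra hn
    have hcl : IsClosed (newtonPolytope p) :=
      ((p.support.finite_toSet.image _).isCompact_convexHull (𝕜 := ℝ)).isClosed
    obtain ⟨f, u, hf1, hf2⟩ := geometric_hahn_banach_point_closed (convex_convexHull ℝ _) hcl hn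
    let w : E → ℝ := fun e => f (Pi.single e 1)
    have hfw : ∀ x : E → ℝ, f x = ∑ e, x e * w e := by
      intro x
      conv_lhs => rw [pi_eq_sum_univ' x]
      simp only [map_sum, map_smul, smul_eq_mul, w]
    obtain ⟨σ, hσ⟩ := exists_equiv_antitone w
    obtain ⟨d, hdp, hd⟩ := h.greedy σ
    have h1 := h.sum_mul_le hσ hdp hd hm
    have h2 := hf2 _ (subset_convexHull ℝ _ ⟨d, hdp, rfl⟩)
    rw [hfw] at h2 hf1
    linarith

/-- Comparing the greedy point of an order in which `I ∩ J`, `I` and `I ∪ J` are initial segments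
with the inequality for `J`. -/
theorem isSupermodular (h : Realizes p z) : IsSupermodular z := by
  intro I J
  let g : E → ℝ := fun e => (if e ∈ I then 2 else 0) + (if e ∈ J then 1 else 0)
  obtain ⟨σ, hσ⟩ := exists_equiv_antitone g
  obtain ⟨d, hdp, hd⟩ := h.greedy σ
  have hseg : ∀ A : Finset E, (∀ e f, g e ≤ g f → e ∈ A → f ∈ A) →
      z A = ∑ e ∈ A, (d e : ℤ) := by
    intro A hA
    have : ∃ k, A = initSeg σ k := by
      by_cases hne : A.Nonempty
      · obtain ⟨e, he, hmax⟩ := A.exists_max_image σ hne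
        refine ⟨(σ e : ℕ) + 1, ?_⟩
        ext f
        rw [mem_initSeg, Nat.lt_succ_iff, ← Fin.le_def]
        exact ⟨fun hf => hmax f hf, fun hf => hA e f (hσ f e hf) he⟩
      · exact ⟨0, by rw [initSeg_zero, Finset.not_nonempty_iff_eq_empty.1 hne]⟩
    obtain ⟨k, rfl⟩ := this
    exact (hd k).symm
  have hIJ := hseg (I ∩ J) (by
    intro e f hef he
    simp only [g] at hef
    by_cases h1 : f ∈ I <;> by_cases h2 : f ∈ J <;> simp_all <;> norm_num at hef)
  have hI := hseg I (by
    intro e f hef he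
    simp only [g] at hef
    by_contra hf
    simp only [if_pos he, if_neg hf] at hef
    split_ifs at hef <;> norm_num at hef)
  have hU := hseg (I ∪ J) (by
    intro e f hef he
    simp only [g] at hef
    by_contra hf
    rw [Finset.mem_union, not_or] at hf
    simp only [if_neg hf.1, if_neg hf.2] at hef
    rcases Finset.mem_union.1 he with he | he <;> simp only [if_pos he] at hef <;>
      split_ifs at hef <;> norm_num at hef)
  have hJ := h.le d hdp J
  have := Finset.sum_union_inter (s₁ := I) (s₂ := J) (f := fun e => (d e : ℤ))
  linarith

end Realizes

theorem sUnion_normalFan {P : Set (E → ℝ)} (hc : IsCompact P) (hne : P.Nonempty) :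
    ⋃₀ normalFan P = Set.univ := by
  refine Set.eq_univ_of_forall fun w => ?_
  obtain ⟨x, hx, hmin⟩ := hc.exists_isMinOn hne
    (f := fun m : E → ℝ => ∑ e, m e * w e) (by fun_prop)
  exact ⟨_, ⟨w, ⟨x, hx, fun y hy => hmin hy⟩, rfl⟩, fun m hm => hm⟩

theorem convex_halfSpace_sum (c : ℝ) (w : E → ℝ) : Convex ℝ {m : E → ℝ | c ≤ ∑ e, m e * w e} := by
  have : IsLinearMap ℝ fun m : E → ℝ => ∑ e, m e * w e :=
    ⟨fun x y => by simp [add_mul, Finset.sum_add_distrib],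
      fun a x => by simp [Finset.mul_sum, mul_assoc]⟩
  exact convex_halfSpace_ge this c

/-- The vertex of the permutahedron corresponding to a numbering of `E`. -/
def permVertex (σ : E ≃ Fin (Fintype.card E)) (e : E) : ℝ := ((σ e : ℕ) : ℝ) + 1

theorem permVertex_mem (σ : E ≃ Fin (Fintype.card E)) : permVertex σ ∈ permutahedron E :=
  subset_convexHull ℝ _ ⟨σ, rfl⟩

/-- Rearrangement inequality: `permVertex σ` minimizes every form decreasing along `σ`. -/
theorem permVertex_mem_polyFace {σ : E ≃ Fin (Fintype.card E)} {u : E → ℝ}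
    (hu : ∀ e f, σ e ≤ σ f → u f ≤ u e) :
    permVertex σ ∈ polyFace (permutahedron E) u := by
  refine ⟨permVertex_mem σ, fun m hm => ?_⟩
  refine convexHull_min ?_ (convex_halfSpace_sum (∑ e, permVertex σ e * u e) u) hm
  rintro _ ⟨τ, rfl⟩
  have hav : Antivary (permVertex σ) u := by
    intro e f hef
    have : ¬ σ e ≤ σ f := fun h => absurd (hu e f h) (not_le.2 hef)
    have h2 : (σ f : ℕ) ≤ σ e := (not_le.1 this).le
    simp only [permVertex]
    exact_mod_cast Nat.succ_le_succ h2
  have := hav.sum_mul_le_sum_comp_perm_mul (σ := τ.trans σ.symm)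
  simpa [permVertex] using this

/-- A form minimal at `permVertex σ` decreases along `σ`: compare with the vertex obtained by
exchanging two values of `σ`. -/
theorem antitone_of_permVertex_mem_polyFace {σ : E ≃ Fin (Fintype.card E)} {w : E → ℝ}
    (h : permVertex σ ∈ polyFace (permutahedron E) w) (e f : E) (hef : σ e ≤ σ f) :
    w f ≤ w e := by
  rcases eq_or_ne e f with rfl | hne
  · exact le_rfl
  have hlt : (σ e : ℕ) < σ f := lt_of_le_of_ne hef fun h => hne (σ.injective (Fin.ext h))
  have h1 := h.2 _ (permVertex_mem ((Equiv.swap e f).trans σ))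
  have h2 : ∑ x, (permVertex ((Equiv.swap e f).trans σ) x - permVertex σ x) * w x
      = ((σ f : ℝ) - σ e) * (w e - w f) := by
    rw [← Finset.sum_subset (Finset.subset_univ {e, f})]
    · rw [Finset.sum_pair hne]
      simp [permVertex]
      ring
    · intro x _ hx
      simp only [Finset.mem_insert, Finset.mem_singleton, not_or] at hx
      simp [permVertex, Equiv.swap_apply_of_ne_of_ne hx.1 hx.2]
  simp only [sub_mul, Finset.sum_sub_distrib] at h2
  have h3 : (0 : ℝ) < (σ f : ℝ) - σ e := by
    rw [sub_pos]
    exact_mod_cast hlt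
  have h4 : 0 ≤ ((σ f : ℝ) - σ e) * (w e - w f) := by linarith
  have := nonneg_of_mul_nonneg_right h4 h3
  linarith

/-- If `w` is minimal along the face of the permutahedron cut out by `u`, then `w` is constant
where `u` is. -/
theorem eq_of_mem_normalCone {u w : E → ℝ}
    (hw : w ∈ normalCone (permutahedron E) (polyFace (permutahedron E) u)) {e f : E}
    (h : u e = u f) : w e = w f := by
  obtain ⟨σ, hσ⟩ := exists_equiv_antitone u
  -- Exchanging `e` and `f` gives a second order along which `u` decreases.
  have hσ' : ∀ x y, ((Equiv.swap e f).trans σ) x ≤ ((Equiv.swap e f).trans σ) y → u y ≤ u x := by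
    have hs : ∀ x, u (Equiv.swap e f x) = u x := by
      intro x
      rw [Equiv.swap_apply_def]
      split_ifs with h1 h2
      · rw [h1, h]
      · rw [h2, h]
      · rfl
    intro x y hxy
    have := hσ _ _ hxy
    rwa [hs, hs] at this
  have h1 := antitone_of_permVertex_mem_polyFace (hw (permVertex_mem_polyFace hσ))
  have h2 := antitone_of_permVertex_mem_polyFace (hw (permVertex_mem_polyFace hσ'))
  rcases le_total (σ e) (σ f) with hle | hle
  · exact le_antisymm (h2 f e (by simpa using hle)) (h1 e f hle)
  · exact le_antisymm (h1 f e hle) (h2 e f (by simpa using hle))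

theorem Realizes.isGeneralizedPermutahedron {p : MvPolynomial E ℂ} {z : Finset E → ℤ}
    (h : Realizes p z) : IsGeneralizedPermutahedron (newtonPolytope p) := by
  have hne : p.support.Nonempty := by
    obtain ⟨d, hd, -⟩ := h.greedy (Fintype.equivFin E)
    exact ⟨d, hd⟩
  refine ⟨⟨p.support.image fun d e => (d e : ℤ), hne.image _, ?_⟩, ⟨z Finset.univ, ?_⟩, ?_, ?_⟩
  · rw [newtonPolytope, Finset.coe_image, Set.image_image]
    simp
  · rw [h.newtonPolytope_eq]
    exact fun m hm => hm.1
  · rw [sUnion_normalFan, sUnion_normalFan]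
    · exact (p.support.finite_toSet.image _).isCompact_convexHull (𝕜 := ℝ)
    · obtain ⟨d, hd⟩ := hne
      exact ⟨_, subset_convexHull ℝ _ ⟨d, hd, rfl⟩⟩
    · exact (Set.finite_range _).isCompact_convexHull (𝕜 := ℝ)
    · exact ⟨_, permVertex_mem (Fintype.equivFin E)⟩
  · rintro _ ⟨u, -, rfl⟩
    obtain ⟨σ, hσ⟩ := exists_equiv_antitone u
    obtain ⟨d, hdp, hd⟩ := h.greedy σ
    have hmem : (fun e => (d e : ℝ)) ∈ newtonPolytope p := subset_convexHull ℝ _ ⟨d, hdp, rfl⟩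
    refine ⟨_, ⟨u, ⟨_, hmem, fun m hm => ?_⟩, rfl⟩, ?_⟩
    · rw [h.newtonPolytope_eq] at hm
      exact h.sum_mul_le hσ hdp hd hm
    · intro w hw m hm
      -- For large `l` both `w` and `l * u - w` decrease along `σ`, so both are minimal at the
      -- greedy point. Their sum is minimal at `m`, hence so is each of them.
      obtain ⟨l, hl⟩ : ∃ l : ℝ, ∀ e f, u f < u e → w e - w f ≤ l * (u e - u f) := by
        obtain ⟨l, hl⟩ := (Set.finite_range
          fun x : E × E => (w x.1 - w x.2) / (u x.1 - u x.2)).bddAbove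
        refine ⟨l, fun e f hef => ?_⟩
        rw [← div_le_iff₀ (sub_pos.2 hef)]
        exact hl ⟨(e, f), rfl⟩
      have hw1 : ∀ e f, σ e ≤ σ f → w f ≤ w e :=
        antitone_of_permVertex_mem_polyFace (hw (permVertex_mem_polyFace hσ))
      have hw2 : ∀ e f, σ e ≤ σ f → l * u f - w f ≤ l * u e - w e := by
        intro e f hef
        rcases (hσ e f hef).lt_or_eq with hlt | heq
        · linarith [hl e f hlt]
        · rw [heq, eq_of_mem_normalCone hw heq]
      have hmb := hm.1
      rw [h.newtonPolytope_eq] at hmb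
      refine ⟨hm.1, fun m' hm' => ?_⟩
      rw [h.newtonPolytope_eq] at hm'
      have h1 := h.sum_mul_le hw1 hdp hd hm'
      have h2 := h.sum_mul_le hw2 hdp hd hmb
      have h3 := hm.2 _ hmem
      have h4 := h.sum_mul_le hσ hdp hd hmb
      have hexp : ∀ x : E → ℝ, ∑ e, x e * (l * u e - w e)
          = l * ∑ e, x e * u e - ∑ e, x e * w e := by
        intro x
        simp only [mul_sub, Finset.sum_sub_distrib, Finset.mul_sum]
        congr 1
        exact Finset.sum_congr rfl fun e _ => by ring
      rw [hexp, hexp, le_antisymm h3 h4] at h2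
      linarith

end Polyhedra

/-! ### Connectivity and loop numbers through the boundary map -/

namespace EdgeGraph

variable {V E : Type*} (G : EdgeGraph V E)

/-- The boundary of an edge, the column of `boundary` belonging to it. -/
def edgeVec (e : E) : V → ℚ :=
  Pi.single (Quot.out (G.ends e)).2 1 - Pi.single (Quot.out (G.ends e)).1 1

/-- The span of the boundaries of the edges in `I`. Its dimension is the rank of `I` in the
graphic matroid. -/
def bspan (I : Finset E) : Submodule ℚ (V → ℚ) :=
  Submodule.span ℚ (G.edgeVec '' (I : Set E))

variable {G}

theorem bspan_mono {I J : Finset E} (h : I ⊆ J) : G.bspan I ≤ G.bspan J :=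
  Submodule.span_mono (Set.image_mono (by exact_mod_cast h))

theorem edgeVec_mem_bspan {I : Finset E} {e : E} (h : e ∈ I) : G.edgeVec e ∈ G.bspan I :=
  Submodule.subset_span ⟨e, by exact_mod_cast h, rfl⟩

theorem bspan_insert (e : E) (I : Finset E) :
    G.bspan (insert e I) = Submodule.span ℚ {G.edgeVec e} ⊔ G.bspan I := by
  rw [bspan, Finset.coe_insert, Set.image_insert_eq, Submodule.span_insert, bspan]

theorem bspan_insert_of_mem {e : E} {I : Finset E} (h : G.edgeVec e ∈ G.bspan I) :
    G.bspan (insert e I) = G.bspan I := by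
  rwa [bspan_insert, sup_eq_right, Submodule.span_singleton_le_iff_mem]

theorem ends_eq_out (e : E) :
    G.ends e = s((Quot.out (G.ends e)).1, (Quot.out (G.ends e)).2) :=
  (Quot.out_eq (G.ends e)).symm

theorem skeleton_adj {I : Finset E} {u v : V} :
    (G.skeleton I).Adj u v ↔ u ≠ v ∧ ∃ e ∈ I, G.ends e = s(u, v) := by
  rw [skeleton, SimpleGraph.fromEdgeSet_adj, and_comm]
  simp

theorem skeleton_mono {I J : Finset E} (h : I ⊆ J) : G.skeleton I ≤ G.skeleton J :=
  SimpleGraph.fromEdgeSet_mono (Set.image_mono (by exact_mod_cast h))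

theorem edgeVec_eq_or {e : E} {u v : V} (h : G.ends e = s(u, v)) :
    G.edgeVec e = Pi.single u 1 - Pi.single v 1 ∨
      G.edgeVec e = -(Pi.single u 1 - Pi.single v 1) := by
  rw [ends_eq_out, Sym2.eq_iff] at h
  rw [neg_sub]
  rcases h with ⟨h1, h2⟩ | ⟨h1, h2⟩
  · right; rw [edgeVec, h1, h2]
  · left; rw [edgeVec, h1, h2]

theorem edgeVec_mem_iff {e : E} {u v : V} (h : G.ends e = s(u, v)) {S : Submodule ℚ (V → ℚ)} :
    G.edgeVec e ∈ S ↔ Pi.single u 1 - Pi.single v 1 ∈ S := by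
  rcases edgeVec_eq_or h with h | h
  · rw [h]
  · rw [h, neg_mem_iff]

theorem reachable_induction {H : SimpleGraph V} {P : V → Prop} {u : V} (hu : P u)
    (hstep : ∀ x y, H.Adj x y → P x → P y) {v : V} (h : H.Reachable u v) : P v := by
  rw [SimpleGraph.reachable_iff_reflTransGen] at h
  induction h with
  | refl => exact hu
  | tail _ hxy ih => exact hstep _ _ hxy ih

/-- Two vertices are connected by edges in `I` if and only if their difference is a boundary of a
chain supported on `I`. If they are not connected, the sum of the coordinates over the connected
component of one of them is a functional that separates them. -/
theorem reachable_iff [Fintype V] {I : Finset E} {u v : V} :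
    (G.skeleton I).Reachable u v ↔ Pi.single u 1 - Pi.single v 1 ∈ G.bspan I := by
  constructor
  · refine reachable_induction (P := fun v => Pi.single u 1 - Pi.single v 1 ∈ G.bspan I)
      (by rw [sub_self]; exact zero_mem _) fun x y hxy hx => ?_
    obtain ⟨-, e, he, hends⟩ := skeleton_adj.1 hxy
    have := add_mem hx ((edgeVec_mem_iff hends).1 (edgeVec_mem_bspan he))
    rwa [sub_add_sub_cancel] at this
  · intro h
    by_contra hn
    let s : Finset V := Finset.univ.filter fun w => (G.skeleton I).Reachable u w
    let f : (V → ℚ) →ₗ[ℚ] ℚ := ∑ w ∈ s, LinearMap.proj w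
    have hf : ∀ x : V, f (Pi.single x 1) = if (G.skeleton I).Reachable u x then 1 else 0 := by
      intro x
      simp [f, s, LinearMap.sum_apply, Pi.single_apply]
    have hker : G.bspan I ≤ LinearMap.ker f := by
      rw [bspan, Submodule.span_le]
      rintro _ ⟨e, he, rfl⟩
      rw [SetLike.mem_coe, edgeVec_mem_iff (ends_eq_out e), LinearMap.mem_ker, map_sub, hf, hf]
      by_cases heq : (Quot.out (G.ends e)).1 = (Quot.out (G.ends e)).2
      · rw [heq, sub_self]
      · have hadj : (G.skeleton I).Reachable (Quot.out (G.ends e)).1 (Quot.out (G.ends e)).2 :=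
          (skeleton_adj.2 ⟨heq, e, he, ends_eq_out e⟩).reachable
        have : (G.skeleton I).Reachable u (Quot.out (G.ends e)).1 ↔
            (G.skeleton I).Reachable u (Quot.out (G.ends e)).2 :=
          ⟨fun h => h.trans hadj, fun h => h.trans hadj.symm⟩
        simp only [this, sub_self]
    have := hker h
    rw [LinearMap.mem_ker, map_sub, hf, hf, if_neg hn,
      if_pos (SimpleGraph.Reachable.refl u)] at this
    norm_num at this

theorem reachable_of_ends [Fintype V] {I : Finset E} {e : E} (he : e ∈ I) {u v : V}
    (h : G.ends e = s(u, v)) :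
    (G.skeleton I).Reachable u v :=
  reachable_iff.2 ((edgeVec_mem_iff h).1 (edgeVec_mem_bspan he))

variable [Fintype E]

theorem boundary_apply (x : E → ℚ) : G.boundary x = ∑ e, x e • G.edgeVec e := rfl

theorem h1_eq_zero_iff {I : Finset E} :
    G.h1 I = 0 ↔ ∀ x : E → ℚ, (∀ e ∉ I, x e = 0) → G.boundary x = 0 → x = 0 := by
  rw [h1, Submodule.finrank_eq_zero, Submodule.eq_bot_iff]
  exact ⟨fun h x h1 h2 => h x ⟨h1, h2⟩, fun h x hx => h x hx.1 hx.2⟩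

theorem h1_mono {I J : Finset E} (h : I ⊆ J) : G.h1 I ≤ G.h1 J :=
  Submodule.finrank_mono fun _ hx => ⟨fun e he => hx.1 e fun he' => he (h he'), hx.2⟩

theorem h1_eq_zero_of_subset {I J : Finset E} (h : I ⊆ J) (hJ : G.h1 J = 0) : G.h1 I = 0 :=
  Nat.le_zero.1 (hJ ▸ h1_mono h)

theorem reachable_univ {c : G.Component} {u v : V} (hu : u ∈ c.supp) (hv : v ∈ c.supp) :
    (G.skeleton Finset.univ).Reachable u v :=
  SimpleGraph.ConnectedComponent.exact (hu.trans hv.symm)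

/-- Rank-nullity for the boundary map restricted to the chains supported on `I`. -/
theorem h1_add_finrank (I : Finset E) :
    G.h1 I + Module.finrank ℚ (G.bspan I) = I.card := by
  let f : (I → ℚ) →ₗ[ℚ] (V → ℚ) := Fintype.linearCombination ℚ fun e : I => G.edgeVec e
  have hr : LinearMap.range f = G.bspan I := by
    rw [Fintype.range_linearCombination, bspan]
    congr 1
    ext x
    simp
  have hsum : ∀ x : E → ℚ, (∀ e ∉ I, x e = 0) → G.boundary x = f fun e => x e := by
    intro x hx
    rw [boundary_apply, Fintype.linearCombination_apply,
      Finset.sum_coe_sort I fun e => x e • G.edgeVec e]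
    refine (Finset.sum_subset (Finset.subset_univ I) fun e _ he => ?_).symm
    rw [hx e he, zero_smul]
  let φ : G.cycles I ≃ₗ[ℚ] LinearMap.ker f :=
    { toFun := fun x => ⟨fun e => x.1 e, by
        rw [LinearMap.mem_ker, ← hsum x.1 x.2.1, x.2.2]⟩
      map_add' := fun _ _ => rfl
      map_smul' := fun _ _ => rfl
      invFun := fun y => ⟨fun e => if h : e ∈ I then y.1 ⟨e, h⟩ else 0, by
        have h0 : ∀ e ∉ I, (fun e => if h : e ∈ I then y.1 ⟨e, h⟩ else 0) e = 0 :=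
          fun e he => dif_neg he
        refine ⟨h0, ?_⟩
        rw [hsum _ h0]
        simp⟩
      left_inv := fun x => by
        ext e
        by_cases h : e ∈ I
        · simp [h]
        · simp [h, x.2.1 e h]
      right_inv := fun y => by
        ext e
        simp }
  have h := LinearMap.finrank_range_add_finrank_ker f
  rw [hr, ← φ.finrank_eq, Module.finrank_fintype_fun_eq_card, Fintype.card_coe] at h
  rw [add_comm]
  exact h

theorem mem_supp_of_reachable {I : Finset E} {c : G.Component} {u v : V} (hu : u ∈ c.supp)
    (h : (G.skeleton I).Reachable u v) : v ∈ c.supp := by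
  rw [SimpleGraph.ConnectedComponent.mem_supp_iff] at hu ⊢
  rw [← hu]
  exact SimpleGraph.ConnectedComponent.sound (h.mono (skeleton_mono (Finset.subset_univ I))).symm

theorem finrank_bspan_of_h1_eq_zero {T : Finset E} (hT : G.h1 T = 0) :
    Module.finrank ℚ (G.bspan T) = T.card := by
  have := h1_add_finrank (G := G) T
  omega

variable [Fintype V]

omit [Fintype V] in
theorem edgeVec_notMem_of_h1_eq_zero {T : Finset E} (hT : G.h1 T = 0) {f : E} (hf : f ∈ T) :
    G.edgeVec f ∉ G.bspan (T.erase f) := by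
  intro h
  have h1 := bspan_insert_of_mem h
  rw [Finset.insert_erase hf] at h1
  have h2 := finrank_bspan_of_h1_eq_zero hT
  rw [h1, finrank_bspan_of_h1_eq_zero (h1_eq_zero_of_subset (Finset.erase_subset f T) hT)] at h2
  exact (Finset.card_erase_lt_of_mem hf).ne h2

theorem h1_insert_eq_zero {F : Finset E} (hF : G.h1 F = 0) {e : E}
    (he : G.edgeVec e ∉ G.bspan F) : G.h1 (insert e F) = 0 := by
  have hlt : G.bspan F < G.bspan (insert e F) :=
    lt_of_le_of_ne (bspan_mono (Finset.subset_insert e F)) fun h =>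
      he (h ▸ edgeVec_mem_bspan (Finset.mem_insert_self e F))
  have h1 := Submodule.finrank_lt_finrank_of_lt hlt
  rw [finrank_bspan_of_h1_eq_zero hF] at h1
  have h2 := h1_add_finrank (G := G) (insert e F)
  have h3 := Finset.card_insert_le e F
  omega

theorem h1_le_card_sdiff {T : Finset E} (hT : G.h1 T = 0) (I : Finset E) :
    G.h1 I ≤ (I \ T).card := by
  have h0 := h1_eq_zero_of_subset (Finset.inter_subset_right (s₁ := I)) hT
  have h1 := finrank_bspan_of_h1_eq_zero h0
  have h2 := Submodule.finrank_mono (bspan_mono (G := G) (Finset.inter_subset_left (s₁ := I)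
    (s₂ := T)))
  have h3 := h1_add_finrank (G := G) I
  have h4 := Finset.card_sdiff_add_card_inter I T
  omega

/-- If a forest `T` meets `I` in as many edges as possible, then `T ∩ I` spans `I`. -/
theorem bspan_inter_eq {T : Finset E} (hT : G.h1 T = 0) {I : Finset E}
    (h : (I \ T).card ≤ G.h1 I) : G.bspan (I ∩ T) = G.bspan I := by
  have h0 := h1_eq_zero_of_subset (Finset.inter_subset_right (s₁ := I)) hT
  have h1 := finrank_bspan_of_h1_eq_zero h0
  have h3 := h1_add_finrank (G := G) I
  have h4 := Finset.card_sdiff_add_card_inter I T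
  exact Submodule.eq_of_le_of_finrank_le (bspan_mono Finset.inter_subset_left) (by omega)

/-! ### Connected components -/

/-- The connected component containing an edge. -/
def edgeComp (G : EdgeGraph V E) (e : E) : G.Component :=
  (G.skeleton Finset.univ).connectedComponentMk (Quot.out (G.ends e)).1

theorem mem_edgesOf_iff {c : G.Component} {e : E} : e ∈ G.edgesOf c ↔ G.edgeComp e = c := by
  have h1 : (Quot.out (G.ends e)).1 ∈ c.supp ↔ G.edgeComp e = c := Iff.rfl
  have h2 : (Quot.out (G.ends e)).2 ∈ c.supp ↔ G.edgeComp e = c := by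
    rw [SimpleGraph.ConnectedComponent.mem_supp_iff, edgeComp]
    rw [SimpleGraph.ConnectedComponent.sound
      (reachable_of_ends (Finset.mem_univ e) (ends_eq_out e))]
  rw [edgesOf, Finset.mem_filter, ends_eq_out]
  simp only [Finset.mem_univ, true_and, Sym2.mem_iff, forall_eq_or_imp, forall_eq, h1, h2,
    and_self]

theorem mem_edgesOf_of_ends {c : G.Component} {e : E} {u v : V} (h : G.ends e = s(u, v))
    (hu : u ∈ c.supp) : e ∈ G.edgesOf c ∧ v ∈ c.supp := by
  have hv : v ∈ c.supp := by
    rw [SimpleGraph.ConnectedComponent.mem_supp_iff] at hu ⊢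
    rw [← hu]
    exact SimpleGraph.ConnectedComponent.sound (reachable_of_ends (Finset.mem_univ e) h).symm
  refine ⟨?_, hv⟩
  rw [edgesOf, Finset.mem_filter, h]
  refine ⟨Finset.mem_univ e, fun w hw => ?_⟩
  rcases Sym2.mem_iff.1 hw with rfl | rfl
  exacts [hu, hv]

/-- A path starting in a component `c` only uses edges of `c`. -/
theorem reachable_inter_edgesOf {I : Finset E} {c : G.Component} {u v : V} (hu : u ∈ c.supp)
    (h : (G.skeleton I).Reachable u v) : (G.skeleton (I ∩ G.edgesOf c)).Reachable u v := by
  have := reachable_induction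
    (P := fun v => v ∈ c.supp ∧ (G.skeleton (I ∩ G.edgesOf c)).Reachable u v)
    ⟨hu, SimpleGraph.Reachable.refl u⟩ (fun x y hxy hx => by
      obtain ⟨-, e, he, hends⟩ := skeleton_adj.1 hxy
      obtain ⟨hec, hy⟩ := mem_edgesOf_of_ends hends hx.1
      exact ⟨hy, hx.2.trans (reachable_of_ends (Finset.mem_inter.2 ⟨he, hec⟩) hends)⟩) h
  exact this.2

/-- A cycle decomposes into its parts in the connected components. -/
theorem h1_eq_zero_of_components {T : Finset E}
    (h : ∀ c : G.Component, G.h1 (T ∩ G.edgesOf c) = 0) : G.h1 T = 0 := by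
  rw [h1_eq_zero_iff]
  intro x hx hb
  funext e
  set c := G.edgeComp e with hc
  let y : E → ℚ := fun e' => if e' ∈ G.edgesOf c then x e' else 0
  have hy : y = 0 := by
    refine h1_eq_zero_iff.1 (h c) y (fun e' he' => ?_) ?_
    · by_cases h1 : e' ∈ G.edgesOf c
      · simp only [y, if_pos h1]
        exact hx e' fun h2 => he' (Finset.mem_inter.2 ⟨h2, h1⟩)
      · simp only [y, if_neg h1]
    · funext v
      have hbv := congrFun hb v
      rw [boundary_apply] at hbv ⊢
      simp only [Finset.sum_apply, Pi.smul_apply, smul_eq_mul, Pi.zero_apply] at hbv ⊢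
      have hz : ∀ e', v ∉ G.ends e' → G.edgeVec e' v = 0 := by
        intro e' he'
        rw [ends_eq_out, Sym2.mem_iff, not_or] at he'
        simp [edgeVec, he'.1, he'.2]
      by_cases hv : v ∈ c.supp
      · rw [← hbv]
        refine Finset.sum_congr rfl fun e' _ => ?_
        by_cases h1 : v ∈ G.ends e'
        · obtain ⟨w, hw⟩ := h1
          simp only [y, if_pos (mem_edgesOf_of_ends hw hv).1]
        · rw [hz e' h1, mul_zero, mul_zero]
      · refine Finset.sum_eq_zero fun e' _ => ?_
        by_cases h1 : e' ∈ G.edgesOf c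
        · rw [hz e' fun h2 => hv ((Finset.mem_filter.1 h1).2 v h2), mul_zero]
        · simp only [y, if_neg h1, zero_mul]
  have := congrFun hy e
  simpa only [y, if_pos (mem_edgesOf_iff.2 hc.symm)] using this

/-! ### Spanning forests and 2-trees -/

/-- Maximal spanning forests: edge sets without cycles that connect whatever `G` connects. -/
def IsSpanningForest (G : EdgeGraph V E) (T : Finset E) : Prop :=
  G.h1 T = 0 ∧ G.bspan T = G.bspan Finset.univ

theorem mem_spanningTrees {c : G.Component} {T : Finset E} :
    T ∈ G.spanningTrees c ↔ T ⊆ G.edgesOf c ∧ G.h1 T = 0 ∧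
      ∀ v ∈ c.supp, ∀ w ∈ c.supp, (G.skeleton T).Reachable v w := by
  rw [spanningTrees, Finset.mem_filter, Finset.mem_powerset]

theorem isSpanningForest_iff {T : Finset E} :
    G.IsSpanningForest T ↔ ∀ c : G.Component, T ∩ G.edgesOf c ∈ G.spanningTrees c := by
  constructor
  · rintro ⟨h1, h2⟩ c
    refine mem_spanningTrees.2 ⟨Finset.inter_subset_right,
      h1_eq_zero_of_subset Finset.inter_subset_left h1, fun v hv w hw => ?_⟩
    refine reachable_inter_edgesOf hv ?_
    rw [reachable_iff, h2, ← reachable_iff]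
    exact reachable_univ hv hw
  · intro h
    refine ⟨h1_eq_zero_of_components fun c => (mem_spanningTrees.1 (h c)).2.1,
      le_antisymm (bspan_mono (Finset.subset_univ T)) ?_⟩
    rw [bspan, Submodule.span_le]
    rintro _ ⟨e, -, rfl⟩
    have he := (Finset.mem_filter.1 (mem_edgesOf_iff.2 (rfl : G.edgeComp e = _))).2
    rw [SetLike.mem_coe, edgeVec_mem_iff (ends_eq_out e), ← reachable_iff]
    refine ((mem_spanningTrees.1 (h (G.edgeComp e))).2.2 _ (he _ ?_) _ (he _ ?_)).mono
      (skeleton_mono Finset.inter_subset_left)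
    · exact Sym2.out_fst_mem _
    · exact Sym2.out_snd_mem _

theorem mem_spanningTwoTrees {c : G.Component} {F : Finset E} :
    F ∈ G.spanningTwoTrees c ↔ F ⊆ G.edgesOf c ∧ G.h1 F = 0 ∧
      Nat.card {d : (G.skeleton F).ConnectedComponent // d.supp ⊆ c.supp} = 2 := by
  rw [spanningTwoTrees, Finset.mem_filter, Finset.mem_powerset]

/-- In a spanning 2-tree two vertices of `c` not connected to a third one are connected. -/
theorem reachable_of_not_reachable {c : G.Component} {F : Finset E}
    (hF : F ∈ G.spanningTwoTrees c) {u v w : V} (hu : u ∈ c.supp) (hv : v ∈ c.supp)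
    (hw : w ∈ c.supp) (h1 : ¬ (G.skeleton F).Reachable u v)
    (h2 : ¬ (G.skeleton F).Reachable u w) : (G.skeleton F).Reachable v w := by
  obtain ⟨a, b, -, hab⟩ := Nat.card_eq_two_iff.1 (mem_spanningTwoTrees.1 hF).2.2
  have hsub : ∀ x ∈ c.supp, ((G.skeleton F).connectedComponentMk x).supp ⊆ c.supp :=
    fun x hx y hy => mem_supp_of_reachable hx (SimpleGraph.ConnectedComponent.exact hy).symm
  have key : ∀ y : {d : (G.skeleton F).ConnectedComponent // d.supp ⊆ c.supp},
      y = a ∨ y = b := by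
    intro y
    have : y ∈ ({a, b} : Set _) := hab ▸ Set.mem_univ y
    simpa using this
  have hr : ∀ {x y} (hx : x ∈ c.supp) (hy : y ∈ c.supp),
      (⟨_, hsub x hx⟩ : {d : (G.skeleton F).ConnectedComponent // d.supp ⊆ c.supp})
        = ⟨_, hsub y hy⟩ → (G.skeleton F).Reachable x y := fun _ _ h =>
    SimpleGraph.ConnectedComponent.exact (congrArg Subtype.val h)
  have n1 := mt (hr hu hv) h1
  have n2 := mt (hr hu hw) h2
  apply hr hv hw
  rcases key ⟨_, hsub u hu⟩ with ku | ku <;> rcases key ⟨_, hsub v hv⟩ with kv | kv <;>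
    rcases key ⟨_, hsub w hw⟩ with kw | kw <;> rw [ku, kv] at n1 <;> rw [ku, kw] at n2 <;>
    rw [kv, kw] <;> contradiction

/-- Some edge of `c` joins the two trees of a 2-tree, and adding it yields a spanning tree. -/
theorem exists_insert_mem_spanningTrees {c : G.Component} {F : Finset E}
    (hF : F ∈ G.spanningTwoTrees c) :
    ∃ f ∈ G.edgesOf c, f ∉ F ∧ insert f F ∈ G.spanningTrees c := by
  obtain ⟨hFc, hF1, hcard⟩ := mem_spanningTwoTrees.1 hF
  obtain ⟨⟨a, ha⟩, ⟨b, hb⟩, hab, -⟩ := Nat.card_eq_two_iff.1 hcard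
  obtain ⟨x, rfl⟩ := a.exists_rep
  obtain ⟨y, rfl⟩ := b.exists_rep
  have hx : x ∈ c.supp := ha rfl
  have hy : y ∈ c.supp := hb rfl
  have hxy : ¬ (G.skeleton F).Reachable x y := fun h =>
    hab (Subtype.ext (SimpleGraph.ConnectedComponent.sound h))
  obtain ⟨u, v, huv, hxu, hxv⟩ : ∃ u v, (G.skeleton Finset.univ).Adj u v ∧
      (G.skeleton F).Reachable x u ∧ ¬ (G.skeleton F).Reachable x v := by
    by_contra! hcon
    exact hxy (reachable_induction (SimpleGraph.Reachable.refl x) hcon (reachable_univ hx hy))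
  obtain ⟨-, f, -, hf⟩ := skeleton_adj.1 huv
  have hu : u ∈ c.supp := mem_supp_of_reachable hx hxu
  obtain ⟨hfc, hv⟩ := mem_edgesOf_of_ends hf hu
  have hfF : G.edgeVec f ∉ G.bspan F := by
    rw [edgeVec_mem_iff hf, ← reachable_iff]
    exact fun h => hxv (hxu.trans h)
  have hle := skeleton_mono (G := G) (Finset.subset_insert f F)
  have hall : ∀ w ∈ c.supp, (G.skeleton (insert f F)).Reachable x w := by
    intro w hw
    by_cases hxw : (G.skeleton F).Reachable x w
    · exact hxw.mono hle
    · exact (hxu.mono hle).trans ((reachable_of_ends (Finset.mem_insert_self f F) hf).trans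
        ((reachable_of_not_reachable hF hx hv hw hxv hxw).mono hle))
  refine ⟨f, hfc, fun h => hfF (edgeVec_mem_bspan h), mem_spanningTrees.2
    ⟨Finset.insert_subset hfc hFc, h1_insert_eq_zero hF1 hfF, fun v hv w hw => ?_⟩⟩
  exact (hall v hv).symm.trans (hall w hw)

theorem erase_mem_spanningTwoTrees {c : G.Component} {T : Finset E}
    (hT : T ∈ G.spanningTrees c) {f : E} (hf : f ∈ T) :
    T.erase f ∈ G.spanningTwoTrees c := by
  obtain ⟨hTc, hT1, hconn⟩ := mem_spanningTrees.1 hT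
  set p := (Quot.out (G.ends f)).1
  set q := (Quot.out (G.ends f)).2
  have hends : G.ends f = s(p, q) := ends_eq_out f
  have hp : p ∈ c.supp := mem_edgesOf_iff.1 (hTc hf)
  have hq : q ∈ c.supp := (mem_edgesOf_of_ends hends hp).2
  have hpq : ¬ (G.skeleton (T.erase f)).Reachable p q := by
    rw [reachable_iff, ← edgeVec_mem_iff hends]
    exact edgeVec_notMem_of_h1_eq_zero hT1 hf
  have hall : ∀ w ∈ c.supp, (G.skeleton (T.erase f)).Reachable p w ∨
      (G.skeleton (T.erase f)).Reachable q w := by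
    intro w hw
    refine reachable_induction (P := fun w => (G.skeleton (T.erase f)).Reachable p w ∨
      (G.skeleton (T.erase f)).Reachable q w) (Or.inl (SimpleGraph.Reachable.refl p))
      (fun x y hxy hx => ?_) (hconn p hp w hw)
    obtain ⟨-, e, he, hxy⟩ := skeleton_adj.1 hxy
    by_cases hef : e = f
    · subst hef
      rw [hends, Sym2.eq_iff] at hxy
      rcases hxy with ⟨-, rfl⟩ | ⟨rfl, -⟩
      · exact Or.inr (SimpleGraph.Reachable.refl _)
      · exact Or.inl (SimpleGraph.Reachable.refl _)
    · have := reachable_of_ends (Finset.mem_erase.2 ⟨hef, he⟩) hxy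
      exact hx.imp (fun h => h.trans this) (fun h => h.trans this)
  have hsub : ∀ x ∈ c.supp, ((G.skeleton (T.erase f)).connectedComponentMk x).supp ⊆ c.supp :=
    fun x hx y hy => mem_supp_of_reachable hx (SimpleGraph.ConnectedComponent.exact hy).symm
  refine mem_spanningTwoTrees.2 ⟨(Finset.erase_subset f T).trans hTc,
    h1_eq_zero_of_subset (Finset.erase_subset f T) hT1, Nat.card_eq_two_iff.2
    ⟨⟨_, hsub p hp⟩, ⟨_, hsub q hq⟩, fun h => hpq (SimpleGraph.ConnectedComponent.exact
      (congrArg Subtype.val h)), Set.eq_univ_of_forall ?_⟩⟩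
  rintro ⟨d, hd⟩
  obtain ⟨w, rfl⟩ := d.exists_rep
  rcases hall w (hd rfl) with h | h
  · left
    exact Subtype.ext (SimpleGraph.ConnectedComponent.sound h.symm)
  · right
    exact Subtype.ext (SimpleGraph.ConnectedComponent.sound h.symm)

/-- A set of edges that is a 2-tree of one component and a spanning tree of the others. -/
def IsCutForest (G : EdgeGraph V E) (c : G.Component) (F : Finset E) : Prop :=
  F ∩ G.edgesOf c ∈ G.spanningTwoTrees c ∧
    ∀ c' ≠ c, F ∩ G.edgesOf c' ∈ G.spanningTrees c'

theorem isCutForest_iff {c : G.Component} {F : Finset E} :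
    G.IsCutForest c F ↔ ∃ f ∈ G.edgesOf c, f ∉ F ∧ G.IsSpanningForest (insert f F) := by
  have hother : ∀ f ∈ G.edgesOf c, ∀ c' ≠ c,
      insert f F ∩ G.edgesOf c' = F ∩ G.edgesOf c' := by
    intro f hf c' hc'
    refine Finset.insert_inter_of_notMem fun h => hc' ?_
    rw [← mem_edgesOf_iff.1 h, mem_edgesOf_iff.1 hf]
  constructor
  · rintro ⟨h1, h2⟩
    obtain ⟨f, hf, hfF, hT⟩ := exists_insert_mem_spanningTrees h1
    refine ⟨f, hf, fun h => hfF (Finset.mem_inter.2 ⟨h, hf⟩), isSpanningForest_iff.2 fun c' => ?_⟩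
    by_cases hc' : c' = c
    · subst hc'
      rwa [Finset.insert_inter_of_mem hf]
    · rw [hother f hf c' hc']
      exact h2 c' hc'
  · rintro ⟨f, hf, hfF, hT⟩
    rw [isSpanningForest_iff] at hT
    refine ⟨?_, fun c' hc' => hother f hf c' hc' ▸ hT c'⟩
    have h1 := hT c
    rw [Finset.insert_inter_of_mem hf] at h1
    have h2 := erase_mem_spanningTwoTrees h1 (Finset.mem_insert_self f _)
    rwa [Finset.erase_insert fun h => hfF (Finset.mem_inter.1 h).1] at h2

theorem IsCutForest.comp_unique {c c' : G.Component} {F : Finset E}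
    (h : G.IsCutForest c F) (h' : G.IsCutForest c' F) : c = c' := by
  by_contra hne
  obtain ⟨f, hf, hfF, hT⟩ := exists_insert_mem_spanningTrees h.1
  have h1 := (mem_spanningTrees.1 (h'.2 c hne)).2.2 (Quot.out (G.ends f)).1
    (mem_edgesOf_iff.1 hf) (Quot.out (G.ends f)).2
    (mem_edgesOf_of_ends (ends_eq_out f) (mem_edgesOf_iff.1 hf)).2
  rw [reachable_iff, ← edgeVec_mem_iff (ends_eq_out f)] at h1
  have h2 := edgeVec_notMem_of_h1_eq_zero (mem_spanningTrees.1 hT).2.1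
    (Finset.mem_insert_self f _)
  rw [Finset.erase_insert hfF] at h2
  exact h2 h1

omit [Fintype V] in
theorem IsSpanningForest.card_compl {T : Finset E} (hT : G.IsSpanningForest T) :
    (Finset.univ \ T).card = G.h1 Finset.univ := by
  have h1 := h1_add_finrank (G := G) Finset.univ
  rw [← hT.2, finrank_bspan_of_h1_eq_zero hT.1] at h1
  have h2 := Finset.card_sdiff_add_card_eq_card (Finset.subset_univ T)
  omega

/-! ### The greedy spanning forest -/

/-- The spanning forest obtained by adding the edges in the order `σ`, skipping those that close a
cycle. -/
def greedyForest (G : EdgeGraph V E) (σ : E ≃ Fin (Fintype.card E)) : Finset E :=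
  Finset.univ.filter fun e => G.edgeVec e ∉ G.bspan (initSeg σ (σ e))

omit [Fintype V] in
theorem mem_greedyForest {σ : E ≃ Fin (Fintype.card E)} {e : E} :
    e ∈ G.greedyForest σ ↔ G.edgeVec e ∉ G.bspan (initSeg σ (σ e)) := by
  simp [greedyForest]

theorem greedyForest_initSeg (σ : E ≃ Fin (Fintype.card E)) (k : ℕ) :
    G.h1 (initSeg σ k ∩ G.greedyForest σ) = 0 ∧
      G.bspan (initSeg σ k ∩ G.greedyForest σ) = G.bspan (initSeg σ k) := by
  induction k with
  | zero =>
    rw [initSeg_zero, Finset.empty_inter]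
    refine ⟨?_, rfl⟩
    have := h1_add_finrank (G := G) ∅
    rw [Finset.card_empty] at this
    omega
  | succ k ih =>
    by_cases hk : k < Fintype.card E
    · obtain ⟨e, he⟩ : ∃ e, (σ e : ℕ) = k := ⟨σ.symm ⟨k, hk⟩, by simp⟩
      subst he
      rw [initSeg_succ']
      by_cases h : e ∈ G.greedyForest σ
      · rw [Finset.insert_inter_of_mem h]
        refine ⟨h1_insert_eq_zero ih.1 ?_, ?_⟩
        · rw [ih.2]
          exact mem_greedyForest.1 h
        · rw [bspan_insert, ih.2, bspan_insert]
      · rw [Finset.insert_inter_of_notMem h,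
          bspan_insert_of_mem (not_not.1 (mt mem_greedyForest.2 h))]
        exact ih
    · have : initSeg σ (k + 1) = initSeg σ k := by
        ext e
        have := (σ e).2
        rw [mem_initSeg, mem_initSeg]
        omega
      rw [this]
      exact ih

theorem isSpanningForest_greedyForest (σ : E ≃ Fin (Fintype.card E)) :
    G.IsSpanningForest (G.greedyForest σ) := by
  have := greedyForest_initSeg (G := G) σ (Fintype.card E)
  rwa [initSeg_card, Finset.univ_inter] at this

theorem card_initSeg_sdiff_greedyForest (σ : E ≃ Fin (Fintype.card E)) (k : ℕ) :
    (initSeg σ k \ G.greedyForest σ).card = G.h1 (initSeg σ k) := by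
  obtain ⟨h1, h2⟩ := greedyForest_initSeg (G := G) σ k
  have h3 := finrank_bspan_of_h1_eq_zero h1
  rw [h2] at h3
  have h4 := h1_add_finrank (G := G) (initSeg σ k)
  have h5 := Finset.card_sdiff_add_card_inter (initSeg σ k) (G.greedyForest σ)
  omega

end EdgeGraph

/-! ### Expansion of the Symanzik polynomials over spanning forests -/

section Indicator

variable {E : Type*}

/-- The exponent of the squarefree monomial with variables indexed by `I`. -/
def indic (I : Finset E) : E →₀ ℕ := ∑ e ∈ I, Finsupp.single e 1

theorem indic_apply (I : Finset E) (e : E) : indic I e = if e ∈ I then 1 else 0 := by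
  simp [indic, Finsupp.finsetSum_apply, Finsupp.single_apply]

theorem C_mul_prod_X (I : Finset E) (a : ℂ) :
    MvPolynomial.C a * ∏ e ∈ I, MvPolynomial.X e = MvPolynomial.monomial (indic I) a := by
  have : ∏ e ∈ I, (MvPolynomial.X e : MvPolynomial E ℂ) = MvPolynomial.monomial (indic I) 1 := by
    rw [indic, MvPolynomial.monomial_sum_one]
    rfl
  rw [this, MvPolynomial.C_mul_monomial, mul_one]

variable [Fintype E]

theorem indic_compl_injective {S T : Finset E}
    (h : indic (Finset.univ \ S) = indic (Finset.univ \ T)) : S = T := by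
  ext e
  have := DFunLike.congr_fun h e
  rw [indic_apply, indic_apply] at this
  by_cases h1 : e ∈ S <;> by_cases h2 : e ∈ T <;> simp_all

theorem sum_indic_compl (I T : Finset E) :
    ∑ e ∈ I, (indic (Finset.univ \ T) e : ℤ) = (I \ T).card := by
  rw [← Finset.filter_notMem_eq_sdiff (s := I), ← Finset.sum_boole]
  refine Finset.sum_congr rfl fun e _ => ?_
  rw [indic_apply]
  by_cases h : e ∈ T <;> simp [h]

end Indicator

namespace EdgeGraph

variable {V E : Type*} [Fintype V] [Fintype E] {G : EdgeGraph V E}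

/-- A product over the components of sums over edge sets of the components is a sum over edge sets
of the whole graph. -/
theorem prod_sum_monomial (S : G.Component → Finset (Finset E))
    (hS : ∀ c, ∀ T ∈ S c, T ⊆ G.edgesOf c) (w : G.Component → Finset E → ℂ) :
    ∏ c, ∑ T ∈ S c, MvPolynomial.C (w c T) * ∏ e ∈ G.edgesOf c \ T, MvPolynomial.X e
      = ∑ T ∈ Finset.univ.filter (fun T => ∀ c, T ∩ G.edgesOf c ∈ S c),
        MvPolynomial.monomial (indic (Finset.univ \ T)) (∏ c, w c (T ∩ G.edgesOf c)) := by
  rw [Finset.prod_univ_sum]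
  have hU : ∀ x ∈ Fintype.piFinset S, ∀ c, Finset.univ.biUnion x ∩ G.edgesOf c = x c := by
    intro x hx c
    rw [Fintype.mem_piFinset] at hx
    ext e
    rw [Finset.mem_inter, Finset.mem_biUnion]
    constructor
    · rintro ⟨⟨c', -, he⟩, hec⟩
      have := hS c' _ (hx c') he
      rw [mem_edgesOf_iff] at this hec
      rwa [← hec, this]
    · exact fun he => ⟨⟨c, Finset.mem_univ c, he⟩, hS c _ (hx c) he⟩
  refine Finset.sum_nbij' (fun x => Finset.univ.biUnion x) (fun T c => T ∩ G.edgesOf c)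
    ?_ ?_ ?_ ?_ ?_
  · intro x hx
    refine Finset.mem_filter.2 ⟨Finset.mem_univ _, fun c => ?_⟩
    rw [hU x hx]
    exact Fintype.mem_piFinset.1 hx c
  · intro T hT
    exact Fintype.mem_piFinset.2 (Finset.mem_filter.1 hT).2
  · intro x hx
    funext c
    exact hU x hx c
  · intro T _
    ext e
    simp [mem_edgesOf_iff]
  · intro x hx
    simp only [hU x hx]
    rw [Finset.prod_mul_distrib, ← map_prod, ← C_mul_prod_X]
    congr 1
    rw [← Finset.prod_biUnion]
    · refine Finset.prod_congr ?_ fun _ _ => rfl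
      ext e
      simp only [Finset.mem_biUnion, Finset.mem_sdiff, Finset.mem_univ, true_and, not_exists]
      constructor
      · rintro ⟨c, hec, hex⟩ c' hc'
        have := hS c' _ (Fintype.mem_piFinset.1 hx c') hc'
        rw [mem_edgesOf_iff] at this hec
        rw [← this, hec] at hc'
        exact hex hc'
      · exact fun h => ⟨_, mem_edgesOf_iff.2 rfl, h _⟩
    · intro c _ c' _ hcc'
      rw [Function.onFun, Finset.disjoint_left]
      intro e he he'
      have h1 := mem_edgesOf_iff.1 (Finset.mem_sdiff.1 he).1
      have h2 := mem_edgesOf_iff.1 (Finset.mem_sdiff.1 he').1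
      exact hcc' (h1.symm.trans h2)

end EdgeGraph

namespace FeynmanGraph

open EdgeGraph

variable {V E : Type*} [Fintype V] [Fintype E] {D : ℕ} (G : FeynmanGraph V E D)

/-- The coefficient of a 2-tree in the massless second Symanzik polynomial. -/
def treeMomentumSq (c : G.Component) (F : Finset E) : ℂ :=
  momentumSq (G.momentum F (G.firstTree c F))

theorem psi_eq : G.psi = ∑ T ∈ Finset.univ.filter G.IsSpanningForest,
    MvPolynomial.monomial (indic (Finset.univ \ T)) 1 := by
  have := prod_sum_monomial (G := G.toEdgeGraph) G.spanningTrees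
    (fun c T hT => (mem_spanningTrees.1 hT).1) (fun _ _ => 1)
  simp only [map_one, one_mul, Finset.prod_const_one] at this
  rw [psi]
  simp only [psiComp]
  rw [this]
  refine Finset.sum_congr ?_ fun _ _ => rfl
  ext T
  rw [Finset.mem_filter, Finset.mem_filter, isSpanningForest_iff]

theorem phiComp_mul_prod_psiComp (c : G.Component) :
    G.phiComp c * ∏ c' ∈ Finset.univ.erase c, G.psiComp c'
      = ∑ F ∈ Finset.univ.filter (G.IsCutForest c),
        MvPolynomial.monomial (indic (Finset.univ \ F))
          (G.treeMomentumSq c (F ∩ G.edgesOf c)) := by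
  have := prod_sum_monomial (G := G.toEdgeGraph)
    (fun c' => if c' = c then G.spanningTwoTrees c' else G.spanningTrees c')
    (fun c' T hT => by
      split_ifs at hT
      exacts [(mem_spanningTwoTrees.1 hT).1, (mem_spanningTrees.1 hT).1])
    (fun c' F => if c' = c then G.treeMomentumSq c' F else 1)
  rw [← Finset.mul_prod_erase _ _ (Finset.mem_univ c)] at this
  simp only [if_true] at this
  rw [phiComp]
  have hpsi : ∀ c' ∈ Finset.univ.erase c, G.psiComp c'
      = ∑ T ∈ if c' = c then G.spanningTwoTrees c' else G.spanningTrees c',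
        MvPolynomial.C (if c' = c then G.treeMomentumSq c' T else 1) *
          ∏ e ∈ G.edgesOf c' \ T, MvPolynomial.X e := by
    intro c' hc'
    simp only [if_neg (Finset.ne_of_mem_erase hc'), map_one, one_mul, psiComp]
  rw [Finset.prod_congr rfl hpsi]
  refine this.trans (Finset.sum_congr ?_ fun F _ => ?_)
  · ext F
    simp only [Finset.mem_filter, Finset.mem_univ, true_and, IsCutForest]
    constructor
    · intro h
      refine ⟨by simpa using h c, fun c' hc' => by simpa [hc'] using h c'⟩
    · rintro ⟨h1, h2⟩ c'
      by_cases hc' : c' = c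
      · subst hc'
        simpa using h1
      · simpa [hc'] using h2 c' hc'
  · rw [Finset.prod_ite_eq' Finset.univ c fun c' => G.treeMomentumSq c' (F ∩ G.edgesOf c')]
    simp

theorem Phi_eq : G.Phi = (∑ c : G.Component, ∑ F ∈ Finset.univ.filter (G.IsCutForest c),
      MvPolynomial.monomial (indic (Finset.univ \ F)) (G.treeMomentumSq c (F ∩ G.edgesOf c))) +
    ∑ e, MvPolynomial.C (G.mass e ^ 2) * (MvPolynomial.X e * G.psi) := by
  have hM : ∑ e, MvPolynomial.C (G.mass e ^ 2) * (MvPolynomial.X e * G.psi)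
      = ∑ c : G.Component, (∑ e ∈ G.edgesOf c,
        MvPolynomial.C (G.mass e ^ 2) * MvPolynomial.X e) * G.psi := by
    rw [← Finset.sum_fiberwise Finset.univ G.edgeComp]
    refine Finset.sum_congr rfl fun c _ => ?_
    rw [Finset.sum_mul]
    refine Finset.sum_congr ?_ fun e _ => by rw [mul_assoc]
    ext e
    rw [mem_edgesOf_iff, Finset.mem_filter]
    simp
  rw [hM, Phi, ← Finset.sum_add_distrib]
  refine Finset.sum_congr rfl fun c _ => ?_
  rw [← phiComp_mul_prod_psiComp, PhiComp, add_mul, mul_assoc, psi,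
    Finset.mul_prod_erase _ _ (Finset.mem_univ c)]

theorem coeff_psi (d : E →₀ ℕ) : G.psi.coeff d =
    ∑ T ∈ Finset.univ.filter G.IsSpanningForest,
      if indic (Finset.univ \ T) = d then 1 else 0 := by
  rw [psi_eq, MvPolynomial.coeff_sum]
  simp only [MvPolynomial.coeff_monomial]

theorem coeff_psi_indic {T : Finset E} (hT : G.IsSpanningForest T) :
    G.psi.coeff (indic (Finset.univ \ T)) = 1 := by
  rw [coeff_psi, Finset.sum_eq_single_of_mem T (Finset.mem_filter.2 ⟨Finset.mem_univ T, hT⟩),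
    if_pos rfl]
  exact fun S _ hne => if_neg fun h => hne (indic_compl_injective h)

theorem exists_of_coeff_psi_ne_zero {d : E →₀ ℕ} (hd : G.psi.coeff d ≠ 0) :
    ∃ T, G.IsSpanningForest T ∧ d = indic (Finset.univ \ T) := by
  rw [coeff_psi] at hd
  obtain ⟨T, hT, h⟩ := Finset.exists_ne_zero_of_sum_ne_zero hd
  exact ⟨T, (Finset.mem_filter.1 hT).2, (not_not.1 fun hn => h (if_neg hn)).symm⟩

theorem coeff_Phi (d : E →₀ ℕ) : G.Phi.coeff d =
    (∑ c : G.Component, ∑ F ∈ Finset.univ.filter (G.IsCutForest c),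
      if indic (Finset.univ \ F) = d then G.treeMomentumSq c (F ∩ G.edgesOf c) else 0) +
    ∑ e, G.mass e ^ 2 * if e ∈ d.support then G.psi.coeff (d - Finsupp.single e 1) else 0 := by
  rw [Phi_eq, MvPolynomial.coeff_add, MvPolynomial.coeff_sum, MvPolynomial.coeff_sum]
  simp only [MvPolynomial.coeff_sum, MvPolynomial.coeff_monomial, MvPolynomial.coeff_C_mul,
    MvPolynomial.coeff_X_mul']

/-- The first Symanzik polynomial realizes the loop number. -/
theorem realizes_psi : Realizes G.psi fun I => (G.h1 I : ℤ) := by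
  refine ⟨fun d hd I => ?_, fun d hd => ?_, fun σ => ?_⟩
  · obtain ⟨T, hT, rfl⟩ := G.exists_of_coeff_psi_ne_zero (MvPolynomial.mem_support_iff.1 hd)
    rw [sum_indic_compl]
    exact_mod_cast h1_le_card_sdiff hT.1 I
  · obtain ⟨T, hT, rfl⟩ := G.exists_of_coeff_psi_ne_zero (MvPolynomial.mem_support_iff.1 hd)
    rw [sum_indic_compl, hT.card_compl]
  · have hT := isSpanningForest_greedyForest (G := G.toEdgeGraph) σ
    refine ⟨indic (Finset.univ \ G.greedyForest σ), MvPolynomial.mem_support_iff.2 ?_,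
      fun k => ?_⟩
    · rw [G.coeff_psi_indic hT]
      exact one_ne_zero
    · rw [sum_indic_compl, card_initSeg_sdiff_greedyForest]

end FeynmanGraph

/-! ### Mass-momentum spanning subgraphs and the second Symanzik polynomial -/

namespace FeynmanGraph

open EdgeGraph

variable {V E : Type*} [Fintype V] [Fintype E] {D : ℕ} {G : FeynmanGraph V E D}

/-- As there is not exactly one external vertex, an external vertex connected to all others is
incident to an edge. -/
theorem isMomentumSpanning_iff (hext : G.ext.card ≠ 1) {I : Finset E} :
    G.IsMomentumSpanning I ↔ ∀ v ∈ G.ext, ∀ w ∈ G.ext, (G.skeleton I).Reachable v w := by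
  refine ⟨fun h => h.2, fun h => ⟨fun v hv => ?_, h⟩⟩
  obtain ⟨w, hw, hwv⟩ : ∃ w ∈ G.ext, w ≠ v := by
    by_contra! hcon
    exact hext (Finset.card_eq_one.2 ⟨v, Finset.eq_singleton_iff_unique_mem.2 ⟨hv, hcon⟩⟩)
  refine (reachable_induction (P := fun x => x = v ∨ ∃ e ∈ I, v ∈ G.ends e) (Or.inl rfl)
    (fun x y hxy hx => Or.inr ?_) (h v hv w hw)).resolve_left hwv
  rcases hx with rfl | hx
  · obtain ⟨-, e, he, hends⟩ := skeleton_adj.1 hxy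
    exact ⟨e, he, hends ▸ Sym2.mem_mk_left _ _⟩
  · exact hx

theorem isMassMomentumSpanning_mono {I J : Finset E} (hIJ : I ⊆ J)
    (h : G.IsMassMomentumSpanning I) : G.IsMassMomentumSpanning J := by
  refine ⟨⟨fun v hv => ?_, fun v hv w hw => (h.1.2 v hv w hw).mono (skeleton_mono hIJ)⟩,
    h.2.trans hIJ⟩
  obtain ⟨e, he, hve⟩ := h.1.1 v hv
  exact ⟨e, hIJ he, hve⟩

theorem not_isMassMomentumSpanning_empty (hkin : G.ext.Nonempty ∨ G.massive.Nonempty) :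
    ¬ G.IsMassMomentumSpanning ∅ := by
  intro h
  rcases hkin with ⟨v, hv⟩ | ⟨e, he⟩
  · obtain ⟨e, he, -⟩ := h.1.1 v hv
    exact Finset.notMem_empty e he
  · exact Finset.notMem_empty e (h.2 he)

/-- External vertices in different components would violate genericity, because the momenta sum to
zero in each component. -/
theorem isMassMomentumSpanning_univ (hgen : G.GenericEuclidean) (hext : G.ext.card ≠ 1) :
    G.IsMassMomentumSpanning Finset.univ := by
  refine ⟨(isMomentumSpanning_iff hext).2 fun v hv w hw => ?_, Finset.subset_univ _⟩
  by_contra hn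
  let c : G.Component := (G.skeleton Finset.univ).connectedComponentMk v
  have h := (hgen (G.ext.filter fun x => x ∈ c.supp) ⟨Finset.filter_subset _ _, fun hsub => hn
    (reachable_univ (c := c) rfl (Finset.mem_filter.1 (hsub hw)).2)⟩
    ⟨v, Finset.mem_filter.2 ⟨hv, rfl⟩⟩).1
  rw [G.conservation c] at h
  simp [momentumSq] at h

theorem momentum_eq (F : Finset E) (d : (G.skeleton F).ConnectedComponent) :
    G.momentum F d = ∑ v ∈ G.ext.filter (fun v => v ∈ d.supp), G.q v := by
  rw [momentum]
  symm
  refine Finset.sum_subset (Finset.filter_subset_filter _ (Finset.subset_univ _)) fun v hv hn => ?_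
  exact G.q_eq_zero v fun hve => hn (Finset.mem_filter.2 ⟨hve, (Finset.mem_filter.1 hv).2⟩)

theorem mem_firstTree_trans {c : G.Component} {F : Finset E} {v w : V}
    (hv : v ∈ (G.firstTree c F).supp) (h : (G.skeleton F).Reachable v w) :
    w ∈ (G.firstTree c F).supp := by
  rw [SimpleGraph.ConnectedComponent.mem_supp_iff] at hv ⊢
  rw [← hv]
  exact SimpleGraph.ConnectedComponent.sound h.symm

theorem out_mem_supp (c : G.Component) : (Quot.out c : V) ∈ c.supp := Quot.out_eq c

theorem mem_supp_of_mem_firstTree {c : G.Component} {F : Finset E} {v : V}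
    (hv : v ∈ (G.firstTree c F).supp) : v ∈ c.supp :=
  mem_supp_of_reachable (out_mem_supp c) (SimpleGraph.ConnectedComponent.exact hv).symm

theorem mem_firstTree_iff {c : G.Component} {F : Finset E} {v : V} :
    v ∈ (G.firstTree c F).supp ↔ (G.skeleton F).Reachable (Quot.out c) v :=
  ⟨fun h => (SimpleGraph.ConnectedComponent.exact h).symm,
    fun h => SimpleGraph.ConnectedComponent.sound h.symm⟩

/-- A 2-tree that does not separate external vertices carries no momentum. -/
theorem treeMomentumSq_eq_zero {c : G.Component} {F : Finset E}
    (h : (∀ v ∈ G.ext, v ∉ (G.firstTree c F).supp) ∨ ∀ v ∈ G.ext, v ∈ (G.firstTree c F).supp) :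
    G.treeMomentumSq c F = 0 := by
  have : G.momentum F (G.firstTree c F) = 0 := by
    rw [momentum_eq]
    rcases h with h | h
    · rw [Finset.filter_false_of_mem h, Finset.sum_empty]
    · rw [Finset.filter_true_of_mem h, ← G.conservation c]
      rw [Finset.filter_true_of_mem fun v hv => mem_supp_of_mem_firstTree (h v hv)]
  rw [treeMomentumSq, this]
  simp [momentumSq]

theorem treeMomentumSq_inter_eq_zero {c : G.Component} {F : Finset E}
    (h : ∀ v ∈ G.ext, ∀ w ∈ G.ext, (G.skeleton F).Reachable v w) :
    G.treeMomentumSq c (F ∩ G.edgesOf c) = 0 := by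
  apply treeMomentumSq_eq_zero
  by_contra! hcon
  obtain ⟨⟨v, hv, hvd⟩, w, hw, hwd⟩ := hcon
  exact hwd (mem_firstTree_trans hvd
    (reachable_inter_edgesOf (mem_supp_of_mem_firstTree hvd) (h v hv w hw)))

/-- A 2-tree that separates external vertices has nonvanishing coefficient by genericity, also
after adding the square of one mass. -/
theorem treeMomentumSq_add_ne_zero (hgen : G.GenericEuclidean) {c : G.Component} {F : Finset E}
    {v w : V} (hv : v ∈ G.ext) (hw : w ∈ G.ext) (hvd : v ∈ (G.firstTree c F).supp)
    (hwd : w ∉ (G.firstTree c F).supp) (f : E) :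
    G.treeMomentumSq c F + G.mass f ^ 2 ≠ 0 := by
  have h := hgen (G.ext.filter fun x => x ∈ (G.firstTree c F).supp)
    ⟨Finset.filter_subset _ _, fun hsub => hwd (Finset.mem_filter.1 (hsub hw)).2⟩
    ⟨v, Finset.mem_filter.2 ⟨hv, hvd⟩⟩
  rw [← momentum_eq] at h
  intro h0
  have hre := congrArg Complex.re h0
  rw [Complex.add_re, Complex.zero_re, treeMomentumSq] at hre
  by_cases hf : f ∈ G.massive
  · exact (h.2 f hf).ne' hre
  · rw [G.mass_eq_zero f hf] at hre
    simp only [ne_eq, OfNat.ofNat_ne_zero, not_false_eq_true, zero_pow, Complex.zero_re,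
      add_zero] at hre
    exact h.1.ne' hre

theorem exists_of_coeff_Phi_ne_zero {d : E →₀ ℕ} (hd : G.Phi.coeff d ≠ 0) :
    (∃ c F, G.IsCutForest c F ∧ G.treeMomentumSq c (F ∩ G.edgesOf c) ≠ 0 ∧
      d = indic (Finset.univ \ F)) ∨
    ∃ e ∈ G.massive, ∃ T, G.IsSpanningForest T ∧
      d = indic (Finset.univ \ T) + Finsupp.single e 1 := by
  rw [coeff_Phi] at hd
  by_contra! hcon
  refine hd ?_
  rw [Finset.sum_eq_zero, Finset.sum_eq_zero, add_zero]
  · intro e _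
    by_cases he : e ∈ G.massive
    · by_cases hed : e ∈ d.support
      · by_cases h0 : G.psi.coeff (d - Finsupp.single e 1) = 0
        · rw [h0, ite_self, mul_zero]
        · obtain ⟨T, hT, h⟩ := G.exists_of_coeff_psi_ne_zero h0
          refine absurd ?_ (hcon.2 e he T hT)
          rw [← h, tsub_add_cancel_of_le]
          rw [Finsupp.single_le_iff]
          exact Nat.one_le_iff_ne_zero.2 (Finsupp.mem_support_iff.1 hed)
      · rw [if_neg hed, mul_zero]
    · rw [G.mass_eq_zero e he]
      simp
  · intro c _
    refine Finset.sum_eq_zero fun F hF => ?_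
    by_cases h : indic (Finset.univ \ F) = d
    · rw [if_pos h]
      by_contra hne
      exact hcon.1 c F (Finset.mem_filter.1 hF).2 hne h.symm
    · rw [if_neg h]

/-- The set function realized by the second Symanzik polynomial. -/
def tFun (G : FeynmanGraph V E D) (I : Finset E) : ℤ :=
  (G.h1 I : ℤ) + if G.IsMassMomentumSpanning I then 1 else 0

/-- A forest `F` meeting `I` in a maximal forest of `I` connects whatever `I` connects. Hence the
complement of a 2-tree separating external vertices has one more edge in `I` than forced by the loop
number if `I` is momentum spanning. -/
theorem tFun_le_card_sdiff {F : Finset E} (hF : G.h1 F = 0)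
    (hsep : ¬ ∀ v ∈ G.ext, ∀ w ∈ G.ext, (G.skeleton F).Reachable v w) (I : Finset E) :
    G.tFun I ≤ (I \ F).card := by
  have h1 := h1_le_card_sdiff hF I
  rw [tFun]
  split_ifs with hI
  · have : G.h1 I ≠ (I \ F).card := by
      intro heq
      refine hsep fun v hv w hw => ?_
      have h2 := hI.1.2 v hv w hw
      rw [reachable_iff, ← bspan_inter_eq hF heq.ge, ← reachable_iff] at h2
      exact h2.mono (skeleton_mono Finset.inter_subset_right)
    omega
  · omega

theorem sum_indic_add_single (I T : Finset E) (f : E) :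
    ∑ e ∈ I, ((indic (Finset.univ \ T) + Finsupp.single f 1 : E →₀ ℕ) e : ℤ)
      = (I \ T).card + if f ∈ I then 1 else 0 := by
  simp only [Finsupp.add_apply, Nat.cast_add, Finset.sum_add_distrib]
  rw [sum_indic_compl]
  congr 1
  simp [Finsupp.single_apply]

/-- As initial segments grow, a single edge `f` makes them mass-momentum spanning. -/
theorem exists_completing_edge (hgen : G.GenericEuclidean) (hext : G.ext.card ≠ 1)
    (hkin : G.ext.Nonempty ∨ G.massive.Nonempty) (σ : E ≃ Fin (Fintype.card E)) :
    ∃ f, ∀ k, G.IsMassMomentumSpanning (initSeg σ k) ↔ f ∈ initSeg σ k := by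
  have hex : ∃ k, G.IsMassMomentumSpanning (initSeg σ k) :=
    ⟨Fintype.card E, by rw [initSeg_card]; exact isMassMomentumSpanning_univ hgen hext⟩
  obtain ⟨k, hk⟩ : ∃ k, Nat.find hex = k + 1 := by
    refine Nat.exists_eq_succ_of_ne_zero fun h0 => ?_
    have := Nat.find_spec hex
    rw [h0, initSeg_zero] at this
    exact not_isMassMomentumSpanning_empty hkin this
  have hkc : k < Fintype.card E := by
    have := Nat.find_min' hex (m := Fintype.card E)
      (by rw [initSeg_card]; exact isMassMomentumSpanning_univ hgen hext)
    omega
  refine ⟨σ.symm ⟨k, hkc⟩, fun j => ?_⟩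
  rw [mem_initSeg, Equiv.apply_symm_apply]
  constructor
  · intro h
    have := Nat.find_min' hex h
    simp only
    omega
  · intro h
    have h2 := Nat.find_spec hex
    rw [hk] at h2
    exact isMassMomentumSpanning_mono (initSeg_mono σ h) h2

/-- Among the massive edges only the completing edge `f` contributes to the coefficient of the
greedy exponent: any other massive edge outside the greedy forest precedes `f`, so it closes a cycle
with the part of the greedy forest before `f`. -/
theorem coeff_psi_sub_single_eq_zero {σ : E ≃ Fin (Fintype.card E)} {f e : E}
    (hf : ∀ k, G.IsMassMomentumSpanning (initSeg σ k) ↔ f ∈ initSeg σ k)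
    (he : e ∈ G.massive) (hef : e ≠ f)
    (hed : e ∈ (indic (Finset.univ \ G.greedyForest σ) + Finsupp.single f 1).support) :
    G.psi.coeff (indic (Finset.univ \ G.greedyForest σ) + Finsupp.single f 1
      - Finsupp.single e 1) = 0 := by
  set T := G.greedyForest σ with hT
  by_contra h0
  obtain ⟨S, hS, h⟩ := G.exists_of_coeff_psi_ne_zero h0
  have hval : ∀ x, (if x ∈ T then 0 else 1) + (if f = x then 1 else 0) - (if e = x then 1 else 0)
      = if x ∈ S then 0 else 1 := by
    intro x
    have := DFunLike.congr_fun h x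
    simp only [Finsupp.tsub_apply, Finsupp.add_apply, indic_apply, Finsupp.single_apply,
      Finset.mem_sdiff, Finset.mem_univ, true_and, ite_not] at this
    exact this
  have heT : e ∉ T := by
    intro heT
    rw [Finsupp.mem_support_iff] at hed
    simp [indic_apply, heT, hef.symm] at hed
  have hfT : f ∈ T := by
    by_contra hfT
    have := hval f
    rw [if_neg hfT, if_pos rfl, if_neg hef] at this
    split_ifs at this
    all_goals omega
  have hST : T.erase f ⊆ S.erase e := by
    intro x hx
    obtain ⟨hxf, hxT⟩ := Finset.mem_erase.1 hx
    refine Finset.mem_erase.2 ⟨fun h => heT (h ▸ hxT), ?_⟩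
    by_contra hxS
    have := hval x
    rw [if_pos hxT, if_neg hxf.symm, if_neg hxS] at this
    omega
  have heS : e ∈ S := by
    by_contra heS
    have := hval e
    rw [if_neg heT, if_neg hef.symm, if_pos rfl, if_neg heS] at this
    omega
  have h1 : e ∈ initSeg σ ((σ f : ℕ) + 1) :=
    ((hf _).2 (by simp [mem_initSeg])).2 he
  rw [initSeg_succ', Finset.mem_insert, mem_initSeg] at h1
  have h2 : G.edgeVec e ∈ G.bspan (initSeg σ (σ e)) := not_not.1 (mt mem_greedyForest.2 heT)
  rw [← (greedyForest_initSeg (G := G.toEdgeGraph) σ (σ e)).2] at h2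
  refine edgeVec_notMem_of_h1_eq_zero hS.1 heS (bspan_mono ?_ h2)
  intro x hx
  obtain ⟨hx1, hx2⟩ := Finset.mem_inter.1 hx
  refine hST (Finset.mem_erase.2 ⟨?_, hx2⟩)
  rintro rfl
  rw [mem_initSeg] at hx1
  have := h1.resolve_left hef
  omega

theorem sum_mass_mul_coeff_psi {σ : E ≃ Fin (Fintype.card E)} {f : E}
    (hf : ∀ k, G.IsMassMomentumSpanning (initSeg σ k) ↔ f ∈ initSeg σ k) :
    let d := indic (Finset.univ \ G.greedyForest σ) + Finsupp.single f 1
    ∑ e, G.mass e ^ 2 * (if e ∈ d.support then G.psi.coeff (d - Finsupp.single e 1) else 0)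
      = G.mass f ^ 2 := by
  intro d
  rw [Finset.sum_eq_single f]
  · have : f ∈ d.support := by simp [d]
    rw [if_pos this, add_tsub_cancel_right,
      G.coeff_psi_indic (isSpanningForest_greedyForest σ), mul_one]
  · intro e _ hef
    by_cases he : e ∈ G.massive
    · split_ifs with hed
      · rw [coeff_psi_sub_single_eq_zero hf he hef hed, mul_zero]
      · rw [mul_zero]
    · rw [G.mass_eq_zero e he]
      simp
  · exact fun h => absurd (Finset.mem_univ f) h

/-- If the completing edge is massless, it joins two parts of the greedy forest which both contain
external vertices. -/
theorem exists_separated {σ : E ≃ Fin (Fintype.card E)} {f : E} (hext : G.ext.card ≠ 1)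
    (hf : ∀ k, G.IsMassMomentumSpanning (initSeg σ k) ↔ f ∈ initSeg σ k)
    (hfm : f ∉ G.massive) : f ∈ G.greedyForest σ ∧ ∃ v ∈ G.ext, ∃ w ∈ G.ext,
      ¬ (G.skeleton ((G.greedyForest σ).erase f)).Reachable v w := by
  have h1 : G.IsMassMomentumSpanning (initSeg σ ((σ f : ℕ) + 1)) :=
    (hf _).2 (by simp [mem_initSeg])
  have h2 : ¬ G.IsMassMomentumSpanning (initSeg σ (σ f)) := fun h =>
    initSeg_symm_notMem σ f ((hf _).1 h)
  rw [initSeg_succ'] at h1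
  have hm : G.massive ⊆ initSeg σ (σ f) := fun e he =>
    Finset.mem_of_mem_insert_of_ne (h1.2 he) fun h => hfm (h ▸ he)
  have h3 : ¬ ∀ v ∈ G.ext, ∀ w ∈ G.ext, (G.skeleton (initSeg σ (σ f))).Reachable v w :=
    fun h => h2 ⟨(isMomentumSpanning_iff hext).2 h, hm⟩
  push Not at h3
  obtain ⟨v, hv, w, hw, hvw⟩ := h3
  have hvw1 := h1.1.2 v hv w hw
  rw [reachable_iff] at hvw hvw1
  have hfT : f ∈ G.greedyForest σ := by
    by_contra hfT
    rw [bspan_insert_of_mem (not_not.1 (mt mem_greedyForest.2 hfT))] at hvw1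
    exact hvw hvw1
  refine ⟨hfT, v, hv, w, hw, fun h => ?_⟩
  rw [reachable_iff] at h
  -- The difference of `v` and `w` involves the boundary of `f`. If it were a boundary of a chain
  -- without `f`, then so would be the boundary of `f`.
  rw [bspan_insert, Submodule.mem_sup] at hvw1
  obtain ⟨y, hy, z, hz, hyz⟩ := hvw1
  obtain ⟨a, rfl⟩ := Submodule.mem_span_singleton.1 hy
  have hz' : z ∈ G.bspan ((G.greedyForest σ).erase f) := by
    rw [← (greedyForest_initSeg (G := G.toEdgeGraph) σ (σ f)).2] at hz
    refine bspan_mono (fun x hx => ?_) hz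
    obtain ⟨hx1, hx2⟩ := Finset.mem_inter.1 hx
    exact Finset.mem_erase.2 ⟨fun h => initSeg_symm_notMem σ f (h ▸ hx1), hx2⟩
  have ha : a ≠ 0 := by
    rintro rfl
    rw [zero_smul, zero_add] at hyz
    exact hvw (hyz ▸ hz)
  refine edgeVec_notMem_of_h1_eq_zero (isSpanningForest_greedyForest (G := G.toEdgeGraph) σ).1 hfT
    ((Submodule.smul_mem_iff _ ha).1 ?_)
  rw [eq_sub_of_add_eq hyz]
  exact sub_mem h hz'

theorem coeff_Phi_greedy_ne_zero {σ : E ≃ Fin (Fintype.card E)} {f : E}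
    (hgen : G.GenericEuclidean) (hext : G.ext.card ≠ 1)
    (hf : ∀ k, G.IsMassMomentumSpanning (initSeg σ k) ↔ f ∈ initSeg σ k) :
    G.Phi.coeff (indic (Finset.univ \ G.greedyForest σ) + Finsupp.single f 1) ≠ 0 := by
  rw [coeff_Phi, sum_mass_mul_coeff_psi hf]
  set T := G.greedyForest σ with hTdef
  have hT : G.IsSpanningForest T := isSpanningForest_greedyForest σ
  have hmass : f ∈ G.massive → G.mass f ^ 2 ≠ 0 := fun h => pow_ne_zero 2 (G.mass_ne_zero f h)
  by_cases hfT : f ∈ T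
  · have hins : insert f (T.erase f) = T := Finset.insert_erase hfT
    have hcut : G.IsCutForest (G.edgeComp f) (T.erase f) :=
      isCutForest_iff.2 ⟨f, mem_edgesOf_iff.2 rfl, Finset.notMem_erase f T, by rwa [hins]⟩
    have hd : indic (Finset.univ \ T.erase f)
        = indic (Finset.univ \ T) + Finsupp.single f 1 := by
      ext x
      simp only [Finsupp.add_apply, indic_apply, Finsupp.single_apply, Finset.mem_sdiff,
        Finset.mem_univ, true_and, Finset.mem_erase]
      by_cases h : f = x
      · subst h
        simp [hfT]
      · simp [h, Ne.symm h]
    rw [Finset.sum_eq_single_of_mem _ (Finset.mem_univ (G.edgeComp f)),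
      Finset.sum_eq_single_of_mem (T.erase f) (Finset.mem_filter.2 ⟨Finset.mem_univ _, hcut⟩),
      if_pos hd]
    · set c := G.edgeComp f
      set F := T.erase f ∩ G.edgesOf c with hF
      by_cases hsep : ∃ v ∈ G.ext, ∃ w ∈ G.ext, v ∈ (G.firstTree c F).supp ∧
          w ∉ (G.firstTree c F).supp
      · obtain ⟨v, hv, w, hw, hvd, hwd⟩ := hsep
        exact treeMomentumSq_add_ne_zero hgen hv hw hvd hwd f
      · push Not at hsep
        rw [treeMomentumSq_eq_zero, zero_add]
        · refine hmass ?_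
          by_contra hfm
          obtain ⟨-, v, hv, w, hw, hvw⟩ := exists_separated hext hf hfm
          have hFle := skeleton_mono (G := G.toEdgeGraph)
            (Finset.inter_subset_left : F ⊆ T.erase f)
          -- `v` and `w` are connected in `T` but not without `f`, so they lie in the component
          -- of `f`.
          have hvwT : (G.skeleton T).Reachable v w := by
            rw [reachable_iff, hT.2, ← reachable_iff]
            exact (isMassMomentumSpanning_univ hgen hext).1.2 v hv w hw
          have hvc : v ∈ c.supp := by
            by_contra hvc
            have h1 := reachable_inter_edgesOf
              (c := (G.skeleton Finset.univ).connectedComponentMk v) rfl hvwT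
            refine hvw (h1.mono (skeleton_mono fun x hx => ?_))
            obtain ⟨hx1, hx2⟩ := Finset.mem_inter.1 hx
            refine Finset.mem_erase.2 ⟨?_, hx1⟩
            rintro rfl
            exact hvc (mem_edgesOf_iff.1 hx2).symm
          have hwc : w ∈ c.supp := mem_supp_of_reachable hvc hvwT
          have hvwF : ¬ (G.skeleton F).Reachable v w := fun h => hvw (h.mono hFle)
          by_cases hvd : v ∈ (G.firstTree c F).supp
          · have hwd := hsep v hv w hw hvd
            rw [mem_firstTree_iff] at hvd hwd
            exact hvwF (hvd.symm.trans hwd)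
          · by_cases hwd : w ∈ (G.firstTree c F).supp
            · exact hvd (hsep w hw v hv hwd)
            · rw [mem_firstTree_iff] at hvd hwd
              exact hvwF (reachable_of_not_reachable hcut.1 (out_mem_supp c) hvc hwc hvd hwd)
        · by_contra! hcon
          obtain ⟨⟨v, hv, hvd⟩, w, hw, hwd⟩ := hcon
          exact hwd (hsep v hv w hw hvd)
    · intro S _ hne
      exact if_neg fun h => hne (indic_compl_injective (h.trans hd.symm))
    · intro c _ hc
      refine Finset.sum_eq_zero fun S hS => if_neg fun h => hc ?_
      rw [← hd] at h
      rw [indic_compl_injective h] at hS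
      exact (Finset.mem_filter.1 hS).2.comp_unique hcut
  · -- The exponent of `f` is `2`, so that only the mass term contributes.
    rw [Finset.sum_eq_zero, zero_add]
    · refine hmass ?_
      by_contra hfm
      exact hfT (exists_separated hext hf hfm).1
    · intro c _
      refine Finset.sum_eq_zero fun S _ => if_neg fun h => ?_
      have := DFunLike.congr_fun h f
      simp only [Finsupp.add_apply, indic_apply, Finsupp.single_apply, Finset.mem_sdiff,
        Finset.mem_univ, true_and, hfT, not_false_eq_true, if_true] at this
      split_ifs at this
      all_goals omega

/-- The second Symanzik polynomial realizes the loop number plus the indicator of mass-momentum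
spanning subgraphs. -/
theorem realizes_Phi (hgen : G.GenericEuclidean) (hext : G.ext.card ≠ 1)
    (hkin : G.ext.Nonempty ∨ G.massive.Nonempty) : Realizes G.Phi G.tFun := by
  have huniv : G.tFun Finset.univ = G.h1 Finset.univ + 1 := by
    rw [tFun, if_pos (isMassMomentumSpanning_univ hgen hext)]
  refine ⟨fun d hd I => ?_, fun d hd => ?_, fun σ => ?_⟩
  · rcases exists_of_coeff_Phi_ne_zero (MvPolynomial.mem_support_iff.1 hd) with
      ⟨c, F, hF, hne, rfl⟩ | ⟨e, he, T, hT, rfl⟩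
    · obtain ⟨f, -, -, hT⟩ := isCutForest_iff.1 hF
      rw [sum_indic_compl]
      exact tFun_le_card_sdiff (h1_eq_zero_of_subset (Finset.subset_insert f F) hT.1)
        (fun h => hne (treeMomentumSq_inter_eq_zero h)) I
    · rw [sum_indic_add_single, tFun]
      have := h1_le_card_sdiff hT.1 I
      by_cases hI : G.IsMassMomentumSpanning I
      · rw [if_pos hI, if_pos (hI.2 he)]
        omega
      · rw [if_neg hI]
        split_ifs <;> omega
  · rw [huniv]
    rcases exists_of_coeff_Phi_ne_zero (MvPolynomial.mem_support_iff.1 hd) with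
      ⟨c, F, hF, hne, rfl⟩ | ⟨e, he, T, hT, rfl⟩
    · obtain ⟨f, -, hfF, hT⟩ := isCutForest_iff.1 hF
      rw [sum_indic_compl, ← hT.card_compl]
      have h1 := Finset.card_sdiff_add_card_eq_card (Finset.subset_univ F)
      have h2 := Finset.card_sdiff_add_card_eq_card (Finset.subset_univ (insert f F))
      have h3 := Finset.card_insert_of_notMem hfF
      omega
    · rw [sum_indic_add_single, hT.card_compl, if_pos (Finset.mem_univ e)]
  · obtain ⟨f, hf⟩ := exists_completing_edge hgen hext hkin σ
    refine ⟨_, MvPolynomial.mem_support_iff.2 (coeff_Phi_greedy_ne_zero hgen hext hf),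
      fun k => ?_⟩
    rw [sum_indic_add_single, card_initSeg_sdiff_greedyForest, tFun]
    simp only [hf k]

theorem realizes_psi_mul_Phi (hgen : G.GenericEuclidean) (hext : G.ext.card ≠ 1)
    (hkin : G.ext.Nonempty ∨ G.massive.Nonempty) : Realizes (G.psi * G.Phi) G.sFun := by
  have h := G.realizes_psi.mul (realizes_Phi hgen hext hkin)
  have hs : G.sFun = fun I => (G.h1 I : ℤ) + G.tFun I := by
    funext I
    rw [sFun, tFun]
    ring
  rwa [hs]

end FeynmanGraph

end

theorem mainTheorem2 {V E : Type*} [Fintype V] [Fintype E] {D : ℕ} (G : FeynmanGraph V E D)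
    (hgen : G.GenericEuclidean)
    (hext : G.ext.card ≠ 1)
    (hkin : G.ext.Nonempty ∨ G.massive.Nonempty) :
    G.feynmanPolytope = basePolyhedron G.sFun ∧
      IsGeneralizedPermutahedron G.feynmanPolytope ∧
      G.sFun ∅ = 0 ∧ IsSupermodular G.sFun := by
  have h := FeynmanGraph.realizes_psi_mul_Phi hgen hext hkin
  exact ⟨h.newtonPolytope_eq, h.isGeneralizedPermutahedron, h.map_empty, h.isSupermodular⟩
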